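/- Let $\gamma>0$, let $\mathbf U:\mathbb T^2\to\mathbb R$ be either $\mathbf U(x_1,x_2)=(2-\sin 2\pi x_1-\sin 2\pi x_2)^\gamma$ or $\mathbf U(x_1,x_2)=(2-\cos 2\pi x_1-\cos 2\pi x_2)^\gamma$, and let $\xi\in\mathbb R^2$ be non-resonant, i.e. $\kappa\cdot\xi\neq0$ for all $\kappa\in\mathbb Z^2\setminus\{0\}$. Put $H(x,p)=\frac12|p|^2-\mathbf U(\xi x)$ for $x,p\in\mathbb R$, and let $\overline H(p)$ be the effective Hamiltonian: the unique constant such that for every $\delta>0$ there is $w_\delta\in \mathrm{BUC}(\mathbb R)\cap\mathrm{Lip}(\mathbb R)$ with $\overline H(p)-\delta\le H(x,p+Dw_\delta(x))\le\overline H(p)+\delta$ in $\mathbb R$ in the viscosity sense. Let $p_0=\int_{\mathbb T^2}(2\mathbf U(\mathbf x))^{1/2}\,d\mathbf x$. For $g$ defined on a set $S\subset\mathbb R$ and $\beta\in(0,1)$, say that $g$ is uniformly locally $\beta$-Hölder on $S$ if for every $R>0$ there is $C$ with $|g(\tilde p)-g(p)|\le C|\tilde p-p|^\beta$ for all $p,\tilde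 p\in S$ with $|\tilde p-p|\le R$; $f\in C^{1,\beta}(S)$, $S$ open, means that $f$ is $C^1$ on $S$ and $f'$ is uniformly locally $\beta$-Hölder on $S$. Then $\overline H$ is differentiable on $[p_0,\infty)$ (from the right at $p_0$). Write $\overline H'$ for this derivative on $[p_0,\infty)$, with $\overline H'(p_0)=\overline H'_+(p_0)$. 1. If $\gamma>2$, then $\overline H'$ is uniformly locally $(\frac12-\frac1\gamma)$-Hölder on $[p_0,\infty)$, and $\overline H\in C^{1,\frac12-\frac1\gamma}(\mathbb R)$. 2. If $\gamma=2$, then for every $M$ there is $C$ such that $|\overline H'(\tilde p)-\overline H'(p)|\le C|\log\overline H(\tilde p)-\log\overline H(p)|$ for all $p,\tilde p\in(p_0,M]$. 3. If $\frac23<\gamma<2$, then $\overline H'$ is uniformly locally $(\frac1\gamma-\frac12)$-Hölder on $[p_0,\infty)$, and $\overline H\in C^{1,\frac1\gamma-\frac12}(\mathbb R\setminus[-p_0,p_0])$. 4. If $\gamma=\frac23$, then there is $C$ such that for all $p,\tilde p\ge p_0$ $$|\overline H'(\tilde p)-\overline H'(p)|\le C\,\bigl|\overline H(\tilde p)(2+|\log\overline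 H(\tilde p)|)-\overline H(p)(2+|\log\overline H(p)|)\bigr|,$$ and for every $m<1$ there is $C$ such that for all $p,\tilde p\ge p_0$ with $\overline H(p),\overline H(\tilde p)\le m$ $$|\overline H'(\tilde p)-\overline H'(p)|\le C\,\bigl|\overline H(\tilde p)(1+|\log\overline H(\tilde p)|)-\overline H(p)(1+|\log\overline H(p)|)\bigr|,$$ where $\mu|\log\mu|=0$ at $\mu=0$. 5. If $0<\gamma<\frac23$, then there is $C$ such that $|\overline H'(\tilde p)-\overline H'(p)|\le C|\tilde p-p|$ for all $p,\tilde p\ge p_0$; moreover $\overline H$ is $C^1$ on $\mathbb R\setminus[-p_0,p_0]$ and $\overline H'$ is Lipschitz there. -/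

import Mathlib

/-- The mechanical Hamiltonian `H(x,p) = |p|² / 2 + V(x)` on `ℝ × ℝ`. -/
noncomputable def mechanicalHamiltonian (V : ℝ → ℝ) (x p : ℝ) : ℝ :=
  |p| ^ 2 / 2 + V x

/-- `w` satisfies `F(x, Dw) ≤ a` on `ℝ` in the viscosity sense. -/
def ViscosityLE (F : ℝ → ℝ → ℝ) (a : ℝ) (w : ℝ → ℝ) : Prop :=
  ∀ φ : ℝ → ℝ, ContDiff ℝ 1 φ → ∀ x : ℝ,
    IsLocalMax (fun y => w y - φ y) x → F x (deriv φ x) ≤ a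

/-- `w` satisfies `a ≤ F(x, Dw)` on `ℝ` in the viscosity sense. -/
def ViscosityGE (F : ℝ → ℝ → ℝ) (a : ℝ) (w : ℝ → ℝ) : Prop :=
  ∀ φ : ℝ → ℝ, ContDiff ℝ 1 φ → ∀ x : ℝ,
    IsLocalMin (fun y => w y - φ y) x → a ≤ F x (deriv φ x)

/-- `w ∈ BUC(ℝ) ∩ Lip(ℝ)` solves `c - δ ≤ H(x, p + Dw(x)) ≤ c + δ` on `ℝ` in the
viscosity sense. -/
def IsApproximateCorrector (H : ℝ → ℝ → ℝ) (p c δ : ℝ) (w : ℝ → ℝ) : Prop :=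
  Bornology.IsBounded (Set.range w) ∧ UniformContinuous w ∧ (∃ K, LipschitzWith K w) ∧
    ViscosityGE (fun x q => H x (p + q)) (c - δ) w ∧
    ViscosityLE (fun x q => H x (p + q)) (c + δ) w

/-- `c` is a constant for which the approximate cell problem at `p` is solvable for
every `δ > 0`. -/
def IsCellConstant (H : ℝ → ℝ → ℝ) (p c : ℝ) : Prop :=
  ∀ δ : ℝ, 0 < δ → ∃ w : ℝ → ℝ, IsApproximateCorrector H p c δ w

/-- The effective Hamiltonian: its value at `p` is the constant `c` for which the
approximate cell problem at `p` is solvable for every `δ > 0`. -/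
noncomputable def effectiveHamiltonian (H : ℝ → ℝ → ℝ) (p : ℝ) : ℝ :=
  Classical.epsilon (IsCellConstant H p)

/-- `κ · ξ ≠ 0` for all nonzero `κ ∈ ℤ²`. -/
def NonResonant (ξ : ℝ × ℝ) : Prop :=
  ∀ κ : ℤ × ℤ, κ ≠ 0 → (κ.1 : ℝ) * ξ.1 + (κ.2 : ℝ) * ξ.2 ≠ 0

/-- The quasi-periodic potential `V(x) = -U(ξ x)`; functions on the two-dimensional torus
are written as functions on `ℝ²` that are 1-periodic in each variable. -/
noncomputable def quasiPeriodicPotential (U : ℝ × ℝ → ℝ) (ξ : ℝ × ℝ) (x : ℝ) : ℝ :=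
  -U (ξ.1 * x, ξ.2 * x)

/-- `U(x₁,x₂) = (2 - sin(2πx₁) - sin(2πx₂))^γ`. -/
noncomputable def sinSuspension (γ : ℝ) (x : ℝ × ℝ) : ℝ :=
  (2 - Real.sin (2 * Real.pi * x.1) - Real.sin (2 * Real.pi * x.2)) ^ γ

/-- `U(x₁,x₂) = (2 - cos(2πx₁) - cos(2πx₂))^γ`. -/
noncomputable def cosSuspension (γ : ℝ) (x : ℝ × ℝ) : ℝ :=
  (2 - Real.cos (2 * Real.pi * x.1) - Real.cos (2 * Real.pi * x.2)) ^ γ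

/-- `p₀`, the integral of `(2U)^(1/2)` over the torus. -/
noncomputable def criticalMomentum (U : ℝ × ℝ → ℝ) : ℝ :=
  ∫ x₁ in (0 : ℝ)..1, ∫ x₂ in (0 : ℝ)..1, Real.sqrt (2 * U (x₁, x₂))

/-- `g` is Hölder continuous on `S` with exponent `β`, with a constant that is uniform
over all pairs of points of `S` at distance at most `R`, for each finite `R`. -/
def UniformlyLocallyHolderOn (β : ℝ) (g : ℝ → ℝ) (S : Set ℝ) : Prop :=
  ∀ R : ℝ, 0 < R → ∃ C : ℝ, ∀ p ∈ S, ∀ q ∈ S, |q - p| ≤ R →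
    |g q - g p| ≤ C * |q - p| ^ β

/-- `f ∈ C^{1,β}` on an open set `S`. -/
def IsC1HolderOn (β : ℝ) (f : ℝ → ℝ) (S : Set ℝ) : Prop :=
  ContDiffOn ℝ 1 f S ∧ UniformlyLocallyHolderOn β (deriv f) S

/-! Both potentials are translates of `-(cosSum)^γ`. At energy `μ ≥ 0` the equation `(p + Dw)² / 2 =
μ + U(ξx)` asks for `p + Dw = ±√(2(μ + U(ξx)))`. A bounded `w` forces `|p|` to be the torus mean of
the right-hand side, called `momentum γ μ`. Conversely, along a non-resonant line every
trigonometric polynomial minus its mean has a bounded primitive, so Weierstrass approximation yields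
smooth approximate correctors. Comparison shows that the cell constant is then exactly `μ`. For `|p|
< p₀ = momentum γ 0` the constant is `0`, with correctors built from distance functions of the
critical metric. So `Hbar` is even, vanishes on `[-p₀, p₀]` and inverts `momentum γ` on `[p₀, ∞)`.

Write `E(a) = ∫ (μ + U)^a`. Then `Hbar' = √2 / E(-1/2)` at `μ = Hbar p`; this is `velocity`, and its
derivative in `μ` is `acceleration = (√2/2) E(-3/2) / E(-1/2)² ≥ 0`. Since `U` is comparable to
`‖x‖^(2γ)` at its zero, rescaling gives `E(-3/2) ≲ μ^(1/γ - 3/2)` for `γ > 2/3`, a logarithm at `γ =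
2/3` and a bounded quantity below it; also `E(-1/2) ≳ μ^(1/γ - 1/2)`, which matters for `γ > 2`.
Bounding `acceleration` by the derivative of an explicit function of `μ` (a power, `log μ`, or `μ`
times a logarithm) controls the increments of the velocity. The local Lipschitz bound for `Hbar`
converts Hölder estimates in `μ` into Hölder estimates in `p`, and away from `p₀` the second
derivative `acceleration * velocity` is bounded. The estimates are carried by
`effectiveHamiltonian_eq_energy`, `effectiveHamiltonian_eq_zero`, `energyIntegral_le_of_gt`,
`le_energyIntegral_half` and `abs_sub_le_of_monotoneOn`. -/

namespace EffectiveHamiltonian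

open Filter Topology Set MeasureTheory

/-! ### Viscosity comparison on the line, and correctors at the critical level. -/

theorem viscosityLE_of_contDiff {F : ℝ → ℝ → ℝ} {a : ℝ} {w : ℝ → ℝ} (hw : ContDiff ℝ 1 w)
    (h : ∀ x, F x (deriv w x) ≤ a) : ViscosityLE F a w := by
  intro φ hφ x hx
  have h1 := hx.deriv_eq_zero
  rw [deriv_fun_sub (hw.differentiable one_ne_zero x) (hφ.differentiable one_ne_zero x)] at h1
  rw [show deriv φ x = deriv w x by linarith]
  exact h x

theorem viscosityGE_of_contDiff {F : ℝ → ℝ → ℝ} {a : ℝ} {w : ℝ → ℝ} (hw : ContDiff ℝ 1 w)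
    (h : ∀ x, a ≤ F x (deriv w x)) : ViscosityGE F a w := by
  intro φ hφ x hx
  have h1 := hx.deriv_eq_zero
  rw [deriv_fun_sub (hw.differentiable one_ne_zero x) (hφ.differentiable one_ne_zero x)] at h1
  rw [show deriv φ x = deriv w x by linarith]
  exact h x

theorem contDiff_sqrt_one_add_sq : ContDiff ℝ 1 (fun x : ℝ => √(1 + x ^ 2)) :=
  ContDiff.sqrt (by fun_prop) (fun x => by positivity)

theorem abs_deriv_sqrt_one_add_sq_le (x : ℝ) :
    |deriv (fun x : ℝ => √(1 + x ^ 2)) x| ≤ 1 := by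
  have h : HasDerivAt (fun x : ℝ => √(1 + x ^ 2)) ((2 * x) / (2 * √(1 + x ^ 2))) x := by
    apply HasDerivAt.sqrt _ (by positivity)
    simpa using (hasDerivAt_pow 2 x).const_add 1
  have h2 : |x| ≤ √(1 + x ^ 2) := Real.abs_le_sqrt (by linarith)
  have h3 : 0 < √(1 + x ^ 2) := by positivity
  rw [h.deriv, mul_div_mul_left _ _ two_ne_zero, abs_div, abs_of_pos h3, div_le_one h3]
  exact h2

theorem tendsto_sqrt_one_add_sq : Tendsto (fun x : ℝ => √(1 + x ^ 2)) (cocompact ℝ) atTop :=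
  tendsto_atTop_mono (fun x => (Real.abs_le_sqrt (by linarith) : |x| ≤ √(1 + x ^ 2)))
    (tendsto_norm_cocompact_atTop (E := ℝ))

/-- A bounded viscosity subsolution, compared with a bounded `C¹` strict supersolution. -/
theorem ViscosityLE.le_of_contDiff {F : ℝ → ℝ → ℝ} {a b ε A : ℝ} {w ψ : ℝ → ℝ}
    (hw : ViscosityLE F a w) (hwc : Continuous w) (hψ : ContDiff ℝ 1 ψ) (hε : 0 < ε)
    (hA : ∀ x, |w x - ψ x| ≤ A) (hb : ∀ x q, |q - deriv ψ x| ≤ ε → b ≤ F x q) : b ≤ a := by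
  -- The penalty `ε√(1 + x²)` forces `w - φ` to attain a maximum on the whole line, while changing
  -- the gradient by at most `ε`.
  set φ : ℝ → ℝ := fun x => ψ x + ε * √(1 + x ^ 2) with hφ
  have hφc : ContDiff ℝ 1 φ := hψ.add (contDiff_const.mul contDiff_sqrt_one_add_sq)
  have hlim : Tendsto (fun x => w x - φ x) (cocompact ℝ) atBot := by
    have h1 : Tendsto (fun x : ℝ => A + -(ε * √(1 + x ^ 2))) (cocompact ℝ) atBot :=
      tendsto_atBot_add_const_left _ _
        (tendsto_neg_atTop_atBot.comp (tendsto_sqrt_one_add_sq.const_mul_atTop hε))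
    refine tendsto_atBot_mono (fun x => ?_) h1
    have := (abs_le.1 (hA x)).2
    simp only [hφ]
    linarith
  obtain ⟨x, hx⟩ := (hwc.sub hφc.continuous).exists_forall_ge hlim
  have h2 := hw φ hφc x (Filter.Eventually.of_forall hx)
  refine (hb x _ ?_).trans h2
  simp only [hφ]
  rw [deriv_fun_add (hψ.differentiable one_ne_zero x)
    ((contDiff_const.mul contDiff_sqrt_one_add_sq).differentiable one_ne_zero x),
    deriv_const_mul _ (contDiff_sqrt_one_add_sq.differentiable one_ne_zero x), add_sub_cancel_left,
    abs_mul, abs_of_pos hε]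
  exact mul_le_of_le_one_right hε.le (abs_deriv_sqrt_one_add_sq_le x)

/-- A bounded viscosity supersolution, compared with a bounded `C¹` strict subsolution. -/
theorem ViscosityGE.le_of_contDiff {F : ℝ → ℝ → ℝ} {a b ε A : ℝ} {w ψ : ℝ → ℝ}
    (hw : ViscosityGE F a w) (hwc : Continuous w) (hψ : ContDiff ℝ 1 ψ) (hε : 0 < ε)
    (hA : ∀ x, |w x - ψ x| ≤ A) (hb : ∀ x q, |q - deriv ψ x| ≤ ε → F x q ≤ b) : a ≤ b := by
  set φ : ℝ → ℝ := fun x => ψ x - ε * √(1 + x ^ 2) with hφ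
  have hφc : ContDiff ℝ 1 φ := hψ.sub (contDiff_const.mul contDiff_sqrt_one_add_sq)
  have hlim : Tendsto (fun x => w x - φ x) (cocompact ℝ) atTop := by
    have h1 : Tendsto (fun x : ℝ => -A + (ε * √(1 + x ^ 2))) (cocompact ℝ) atTop :=
      tendsto_atTop_add_const_left _ _ (tendsto_sqrt_one_add_sq.const_mul_atTop hε)
    refine tendsto_atTop_mono (fun x => ?_) h1
    have := (abs_le.1 (hA x)).1
    simp only [hφ]
    linarith
  obtain ⟨x, hx⟩ := (hwc.sub hφc.continuous).exists_forall_le hlim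
  have h2 := hw φ hφc x (Filter.Eventually.of_forall hx)
  refine h2.trans (hb x _ ?_)
  simp only [hφ]
  rw [deriv_fun_sub (hψ.differentiable one_ne_zero x)
    ((contDiff_const.mul contDiff_sqrt_one_add_sq).differentiable one_ne_zero x),
    deriv_const_mul _ (contDiff_sqrt_one_add_sq.differentiable one_ne_zero x), sub_sub_cancel_left,
    abs_neg, abs_mul, abs_of_pos hε]
  exact mul_le_of_le_one_right hε.le (abs_deriv_sqrt_one_add_sq_le x)

/-- A viscosity subsolution is touched from above by a parabola near every point. -/
theorem ViscosityLE.exists_near {F : ℝ → ℝ → ℝ} {a A : ℝ} {w : ℝ → ℝ}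
    (hw : ViscosityLE F a w) (hwc : Continuous w) (hA : ∀ x, |w x| ≤ A) (z : ℝ) {r : ℝ}
    (hr : 0 < r) : ∃ x q, |x - z| < r ∧ F x q ≤ a := by
  -- At distance `r` the parabola has height `2A + 1`, more than the oscillation `2A` of `w`, so the
  -- contact point stays within `r` of `z`.
  set k : ℝ := (2 * A + 1) / r ^ 2 with hk
  have hA0 : 0 ≤ A := (abs_nonneg _).trans (hA 0)
  have hk0 : 0 < k := by positivity
  set φ : ℝ → ℝ := fun x => k * (x - z) ^ 2 with hφ
  have hφc : ContDiff ℝ 1 φ := by fun_prop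
  obtain ⟨x, -, hx⟩ := isCompact_Icc.exists_isMaxOn (s := Icc (z - r) (z + r))
    ⟨z, by constructor <;> linarith⟩ (hwc.sub hφc.continuous).continuousOn
  have hmax : ∀ y, w y - φ y ≤ w x - φ x := by
    have hz : w z - φ z ≤ w x - φ x := hx (show z ∈ Icc (z - r) (z + r) by constructor <;> linarith)
    intro y
    by_cases hy : y ∈ Icc (z - r) (z + r)
    · exact hx hy
    · refine le_trans ?_ hz
      have h1 : r ^ 2 ≤ (y - z) ^ 2 := by
        rw [sq_le_sq, abs_of_pos hr]
        by_contra! h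
        rw [abs_lt] at h
        exact hy ⟨by linarith, by linarith⟩
      have h2 : k * r ^ 2 = 2 * A + 1 := by rw [hk]; field_simp
      have h3 := mul_le_mul_of_nonneg_left h1 hk0.le
      have h4 := abs_le.1 (hA y)
      have h5 := abs_le.1 (hA z)
      simp only [hφ]
      simp only [sub_self, ne_eq, OfNat.ofNat_ne_zero, not_false_eq_true, zero_pow, mul_zero]
      linarith
  refine ⟨x, _, ?_, hw φ hφc x (Filter.Eventually.of_forall hmax)⟩
  by_contra! h
  have h1 : r ^ 2 ≤ (x - z) ^ 2 := by rw [sq_le_sq, abs_of_pos hr]; exact h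
  have h2 : k * r ^ 2 = 2 * A + 1 := by rw [hk]; field_simp
  have h3 := mul_le_mul_of_nonneg_left h1 hk0.le
  have h4 := abs_le.1 (hA x)
  have h5 := abs_le.1 (hA z)
  have h6 := hmax z
  simp only [hφ, sub_self, ne_eq, OfNat.ofNat_ne_zero, not_false_eq_true, zero_pow, mul_zero] at h6
  linarith

/-- A function whose increments are dominated by those of `S` is a subsolution of `|Dw| ≤ S'`. -/
theorem abs_deriv_le_of_isLocalMax {f φ S : ℝ → ℝ} {x s : ℝ} (hS : HasDerivAt S s x)
    (hφ : DifferentiableAt ℝ φ x) (hf : ∀ y, |f x - f y| ≤ |S x - S y|) (hSm : Monotone S)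
    (hx : IsLocalMax (fun y => f y - φ y) x) : |deriv φ x| ≤ s := by
  have hd := hφ.hasDerivAt
  rw [abs_le]
  constructor
  -- For `y > x`, maximality gives `φ y - φ x ≥ f y - f x ≥ -(S y - S x)`, so right slopes of `φ +
  -- S` are nonnegative. Left slopes of `φ - S` give the other bound.
  · have h1 : Tendsto (slope (φ + S) x) (𝓝[>] x) (𝓝 (deriv φ x + s)) :=
      (hasDerivAt_iff_tendsto_slope.1 (hd.add hS)).mono_left
        (nhdsWithin_mono _ fun y (hy : x < y) => hy.ne')
    have h2 : 0 ≤ deriv φ x + s := by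
      refine ge_of_tendsto h1 ?_
      filter_upwards [hx.filter_mono nhdsWithin_le_nhds, self_mem_nhdsWithin] with y hy hxy
      have hxy : x < y := hxy
      rw [slope_def_field]
      apply div_nonneg _ (by linarith)
      have h3 := hf y
      rw [abs_of_nonpos (show S x - S y ≤ 0 by linarith [hSm hxy.le]), abs_le] at h3
      simp only [Pi.add_apply]
      linarith
    linarith
  · have h1 : Tendsto (slope (φ - S) x) (𝓝[<] x) (𝓝 (deriv φ x - s)) :=
      (hasDerivAt_iff_tendsto_slope.1 (hd.sub hS)).mono_left
        (nhdsWithin_mono _ fun y (hy : y < x) => hy.ne)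
    have h2 : deriv φ x - s ≤ 0 := by
      refine le_of_tendsto h1 ?_
      filter_upwards [hx.filter_mono nhdsWithin_le_nhds, self_mem_nhdsWithin] with y hy hxy
      have hxy : y < x := hxy
      rw [slope_def_field]
      apply div_nonpos_of_nonneg_of_nonpos _ (by linarith)
      have h3 := hf y
      rw [abs_of_nonneg (show 0 ≤ S x - S y by linarith [hSm hxy.le]), abs_le] at h3
      simp only [Pi.sub_apply]
      linarith
    linarith

/-- An approximate corrector at level `0` below the critical momentum: the infimum, over the set
where the potential is almost maximal, of the distance functions of the critical metric `s |dx|`. -/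
theorem exists_approximateCorrector_zero {V s S : ℝ → ℝ} {p δ L A c T : ℝ}
    (hs0 : ∀ x, 0 ≤ s x) (hsL : ∀ x, s x ≤ L) (hsc : Continuous s)
    (hS : ∀ x, HasDerivAt S (s x) x) (hV : ∀ x, V x = -(s x ^ 2 / 2)) (hδ : 0 < δ) (hpc : |p| < c)
    (hco : ∀ x z, c * |x - z| - A ≤ |S x - S z|)
    (hT : ∀ x, ∃ z, |x - z| ≤ T ∧ s z ^ 2 / 2 ≤ δ) :
    ∃ w, IsApproximateCorrector (mechanicalHamiltonian V) p 0 δ w := by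
  have hSd : Differentiable ℝ S := fun x => (hS x).differentiableAt
  have hScont : Continuous S := hSd.continuous
  have hSm : Monotone S := monotone_of_deriv_nonneg hSd fun x => by rw [(hS x).deriv]; exact hs0 x
  have hL0 : 0 ≤ L := (hs0 0).trans (hsL 0)
  have hSL : ∀ x y, |S x - S y| ≤ L * |x - y| := by
    intro x y
    have := Convex.norm_image_sub_le_of_norm_hasDerivWithin_le (f := S) (f' := s) (C := L)
      (s := univ) (x := y) (y := x) (fun x _ => (hS x).hasDerivWithinAt)
      (fun x _ => by rw [Real.norm_eq_abs, abs_of_nonneg (hs0 x)]; exact hsL x) convex_univ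
      (mem_univ _) (mem_univ _)
    simpa [Real.norm_eq_abs] using this
  -- On `Z` the potential is at least `-δ`, so the supersolution inequality holds there whatever the
  -- gradient.
  set Z : Set ℝ := {z | s z ^ 2 / 2 ≤ δ} with hZ
  have hZc : IsClosed Z := isClosed_le (by fun_prop) continuous_const
  -- Since `|S x - S z|` grows at least like `c|z|` and `c > |p|`, the cost is coercive in `z` and
  -- the infimum over the closed set `Z` is attained.
  have hatt : ∀ x, ∃ z ∈ Z, ∀ y ∈ Z, |S x - S z| + p * z ≤ |S x - S y| + p * y := by
    intro x
    obtain ⟨z₀, -, hz₀⟩ := hT x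
    have hlim : Tendsto (fun z : ℝ => |S x - S z| + p * z) (cocompact ℝ) atTop := by
      have h1 : Tendsto (fun z : ℝ => (c - |p|) * |z| + (-A - c * |x|)) (cocompact ℝ) atTop :=
        tendsto_atTop_add_const_right _ _
          ((tendsto_norm_cocompact_atTop (E := ℝ)).const_mul_atTop (by linarith))
      refine tendsto_atTop_mono (fun z => ?_) h1
      have h2 := hco x z
      have h3 : |z| - |x| ≤ |x - z| := by rw [abs_sub_comm]; exact abs_sub_abs_le_abs_sub z x
      have h4 := mul_le_mul_of_nonneg_left h3 ((abs_nonneg p).trans hpc.le)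
      have h5 : -(|p| * |z|) ≤ p * z := by rw [← abs_mul]; exact neg_abs_le _
      linarith
    obtain ⟨z, hz, hmin⟩ := ContinuousOn.exists_isMinOn'
      (f := fun z : ℝ => |S x - S z| + p * z) (by fun_prop) hZc hz₀
      ((hlim.eventually_ge_atTop _).filter_mono inf_le_left)
    exact ⟨z, hz, fun y hy => hmin hy⟩
  choose ζ hζZ hζ using hatt
  set f : ℝ → ℝ := fun x => |S x - S (ζ x)| + p * ζ x with hf
  have hle : ∀ x z, z ∈ Z → f x ≤ |S x - S z| + p * z := fun x z hz => hζ x z hz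
  have hinc' : ∀ x y, f x - f y ≤ |S x - S y| := by
    intro x y
    have h1 := hle x (ζ y) (hζZ y)
    have h2 := abs_sub_le (S x) (S y) (S (ζ y))
    simp only [hf] at h1 ⊢
    linarith
  have hinc : ∀ x y, |f x - f y| ≤ |S x - S y| := by
    intro x y
    rw [abs_le]
    have := hinc' y x
    rw [abs_sub_comm] at this
    exact ⟨by linarith, hinc' x y⟩
  set w : ℝ → ℝ := fun x => f x - p * x with hw
  have hwL : LipschitzWith (L + |p|).toNNReal w := by
    apply LipschitzWith.of_dist_le_mul
    intro x y
    rw [Real.dist_eq, Real.dist_eq, Real.coe_toNNReal _ (by positivity)]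
    calc |w x - w y| = |(f x - f y) - p * (x - y)| := by simp only [hw]; ring_nf
      _ ≤ |f x - f y| + |p * (x - y)| := abs_sub _ _
      _ ≤ L * |x - y| + |p| * |x - y| := by
        rw [abs_mul]; exact add_le_add_left ((hinc x y).trans (hSL x y)) _
      _ = _ := by ring
  refine ⟨w, ?_, hwL.uniformContinuous, ⟨_, hwL⟩, ?_, ?_⟩
  · rw [isBounded_iff_forall_norm_le]
    -- The lower bound `-A` comes from `hco` and `|p| < c`; the upper bound comes from competing
    -- with a point of `Z` within distance `T` of `x`.
    refine ⟨max A (L * T + |p| * T), ?_⟩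
    rintro _ ⟨x, rfl⟩
    obtain ⟨z, hzT, hz⟩ := hT x
    have h1 := hle x z hz
    have h2 := hSL x z
    have h3 := mul_le_mul_of_nonneg_left hzT hL0
    have h4 : |p * (x - z)| ≤ |p| * T := by
      rw [abs_mul]; exact mul_le_mul_of_nonneg_left hzT (abs_nonneg p)
    have h5 : |p * (x - ζ x)| = |p| * |x - ζ x| := abs_mul _ _
    have h6 := hco x (ζ x)
    have h7 := mul_le_mul_of_nonneg_right hpc.le (abs_nonneg (x - ζ x))
    have h8 := abs_le.1 h4
    have h9 := le_abs_self (p * (x - ζ x))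
    rw [Real.norm_eq_abs, abs_le]
    constructor
    · have : -A ≤ w x := by simp only [hw, hf]; linarith
      linarith [le_max_left A (L * T + |p| * T)]
    · have : w x ≤ L * T + |p| * T := by simp only [hw]; linarith
      exact this.trans (le_max_right _ _)
  · intro φ hφ x hx
    simp only [mechanicalHamiltonian, hV, sq_abs]
    by_cases hxZ : x ∈ Z
    · have h1 : s x ^ 2 / 2 ≤ δ := hxZ
      nlinarith [sq_nonneg (p + deriv φ x)]
    have hsx : 0 < s x := by
      refine (hs0 x).lt_of_ne fun h => hxZ ?_
      show s x ^ 2 / 2 ≤ δ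
      rw [← h]; simpa using hδ.le
    set z := ζ x with hzdef
    have hzx : z ≠ x := fun h => hxZ (h ▸ hζZ x)
    -- If `S x = S z`, the monotone `S` would be constant between `z` and `x`, making `x` a local
    -- extremum of `S` although `S' = s x > 0`.
    have hSne : S x - S z ≠ 0 := by
      intro h
      rcases lt_or_gt_of_ne hzx with h1 | h1
      · have : IsLocalMin S x := by
          filter_upwards [eventually_gt_nhds h1] with y hy
          linarith [hSm hy.le]
        linarith [this.hasDerivAt_eq_zero (hS x)]
      · have : IsLocalMax S x := by
          filter_upwards [eventually_lt_nhds h1] with y hy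
          linarith [hSm hy.le]
        linarith [this.hasDerivAt_eq_zero (hS x)]
    -- Freezing the minimiser `z` gives a function above `w` that touches it at `x` and is
    -- differentiable there; hence `p + φ' = ±s x`.
    have hmin : IsLocalMin (fun y => |S y - S z| + p * z - p * y - φ y) x := by
      filter_upwards [hx] with y hy
      have h1 := hle y z (hζZ x)
      simp only [hw] at hy
      have h2 : f x = |S x - S z| + p * z := rfl
      linarith
    have hφd := (hφ.differentiable one_ne_zero x).hasDerivAt
    have hlin : HasDerivAt (fun y => p * z - p * y - φ y) (-p - deriv φ x) x := by
      simpa using (((hasDerivAt_id x).const_mul p).const_sub (p * z)).fun_sub hφd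
    have hsq : (p + deriv φ x) ^ 2 = s x ^ 2 := by
      rcases lt_or_gt_of_ne hSne with h1 | h1
      · have h2 : HasDerivAt (fun y => |S y - S z| + p * z - p * y - φ y)
            (-s x + (-p - deriv φ x)) x := by
          refine (((hS x).sub_const (S z)).neg.add hlin).congr_of_eventuallyEq ?_
          filter_upwards [(hScont.sub continuous_const).continuousAt.eventually_lt_const h1]
            with y hy
          simp only [Pi.add_apply, Pi.neg_apply]
          rw [abs_of_neg (show S y - S z < 0 from hy)]
          ring
        have h3 := hmin.hasDerivAt_eq_zero h2
        rw [show p + deriv φ x = -s x by linarith]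
        ring
      · have h2 : HasDerivAt (fun y => |S y - S z| + p * z - p * y - φ y)
            (s x + (-p - deriv φ x)) x := by
          refine (((hS x).sub_const (S z)).add hlin).congr_of_eventuallyEq ?_
          filter_upwards [(hScont.sub continuous_const).continuousAt.eventually_const_lt h1]
            with y hy
          simp only [Pi.add_apply]
          rw [abs_of_pos (show 0 < S y - S z from hy)]
          ring
        have h3 := hmin.hasDerivAt_eq_zero h2
        rw [show p + deriv φ x = s x by linarith]
    rw [hsq]
    linarith
  · intro φ hφ x hx
    simp only [mechanicalHamiltonian, hV]
    have hφd := (hφ.differentiable one_ne_zero x)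
    have hmax : IsLocalMax (fun y => f y - (p * y + φ y)) x := by
      filter_upwards [hx] with y hy
      simp only [hw] at hy
      linarith
    have h1 := abs_deriv_le_of_isLocalMax (hS x) (φ := fun y => p * y + φ y) (by fun_prop)
      (fun y => hinc x y) hSm hmax
    rw [deriv_fun_add (by fun_prop) hφd, deriv_const_mul _ (by fun_prop)] at h1
    simp only [deriv_id'', mul_one] at h1
    have h2 := pow_le_pow_left₀ (abs_nonneg _) h1 2
    linarith

/-! ### Trigonometric polynomials and means along non-resonant lines. -/

/-- The function `2 - cos 2πx₁ - cos 2πx₂` on the torus. -/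
noncomputable def cosSum (x : ℝ × ℝ) : ℝ :=
  2 - Real.cos (2 * Real.pi * x.1) - Real.cos (2 * Real.pi * x.2)

/-- A fundamental cell of the torus. -/
def cell : Set (ℝ × ℝ) := Metric.closedBall 0 (1 / 2)

theorem cell_eq : cell = Icc (-(1 / 2)) (1 / 2) ×ˢ Icc (-(1 / 2)) (1 / 2) := by
  rw [cell, show (0 : ℝ × ℝ) = (0, 0) from rfl, ← closedBall_prod_same, Real.closedBall_eq_Icc]
  simp

theorem isCompact_cell : IsCompact cell := isCompact_closedBall _ _

theorem measurableSet_cell : MeasurableSet cell := isCompact_cell.measurableSet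

theorem volume_cell : volume cell = 1 := by
  rw [cell_eq, Measure.volume_eq_prod, Measure.prod_prod, Real.volume_Icc]
  norm_num

instance : IsProbabilityMeasure (volume.restrict cell) :=
  ⟨by rw [Measure.restrict_apply_univ, volume_cell]⟩

theorem integral_cell_eq {f : ℝ × ℝ → ℝ} (hf : Continuous f) :
    ∫ x in cell, f x =
      ∫ x in (-(1 / 2) : ℝ)..(1 / 2), ∫ y in (-(1 / 2) : ℝ)..(1 / 2), f (x, y) := by
  have hle : (-(1 / 2) : ℝ) ≤ 1 / 2 := by norm_num
  rw [cell_eq, Measure.volume_eq_prod, setIntegral_prod, intervalIntegral.integral_of_le hle,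
    integral_Icc_eq_integral_Ioc]
  · simp_rw [integral_Icc_eq_integral_Ioc, ← intervalIntegral.integral_of_le hle]
  · rw [← Measure.volume_eq_prod, ← cell_eq]
    exact hf.continuousOn.integrableOn_compact isCompact_cell

theorem continuous_cosSum : Continuous cosSum := by unfold cosSum; fun_prop

theorem cosSum_nonneg (x : ℝ × ℝ) : 0 ≤ cosSum x := by
  unfold cosSum
  linarith [Real.cos_le_one (2 * Real.pi * x.1), Real.cos_le_one (2 * Real.pi * x.2)]

theorem cosSum_le_four (x : ℝ × ℝ) : cosSum x ≤ 4 := by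
  unfold cosSum
  linarith [Real.neg_one_le_cos (2 * Real.pi * x.1), Real.neg_one_le_cos (2 * Real.pi * x.2)]

/-- The monomial `cos (2π κ·x + c)`. -/
noncomputable def trigMonomial (k l : ℤ) (c : ℝ) (x : ℝ × ℝ) : ℝ :=
  Real.cos (2 * Real.pi * (k * x.1 + l * x.2) + c)

/-- Real trigonometric polynomials in two variables. -/
def trigPolynomials : Submodule ℝ (ℝ × ℝ → ℝ) :=
  Submodule.span ℝ (range fun k : ℤ × ℤ × ℝ => trigMonomial k.1 k.2.1 k.2.2)

theorem trigMonomial_mem (k l : ℤ) (c : ℝ) : trigMonomial k l c ∈ trigPolynomials :=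
  Submodule.subset_span ⟨(k, l, c), rfl⟩

/-- Product-to-sum formulas: multiplication by `cosSum` moves one frequency by `±1`. Hence all
polynomials in `cosSum` are trigonometric polynomials. -/
theorem mul_cosSum_mem {f : ℝ × ℝ → ℝ} (hf : f ∈ trigPolynomials) :
    f * cosSum ∈ trigPolynomials := by
  induction hf using Submodule.span_induction with
  | mem f hf =>
    obtain ⟨⟨k, l, c⟩, rfl⟩ := hf
    have h : trigMonomial k l c * cosSum = (2 : ℝ) • trigMonomial k l c
        - (1 / 2 : ℝ) • (trigMonomial (k + 1) l c + trigMonomial (k - 1) l c)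
        - (1 / 2 : ℝ) • (trigMonomial k (l + 1) c + trigMonomial k (l - 1) c) := by
      ext x
      simp only [Pi.mul_apply, Pi.sub_apply, Pi.add_apply, Pi.smul_apply, smul_eq_mul,
        trigMonomial, cosSum]
      push_cast
      have e1 : 2 * Real.pi * ((k + 1) * x.1 + l * x.2) + c
          = 2 * Real.pi * (k * x.1 + l * x.2) + c + 2 * Real.pi * x.1 := by ring
      have e2 : 2 * Real.pi * ((k - 1) * x.1 + l * x.2) + c
          = 2 * Real.pi * (k * x.1 + l * x.2) + c - 2 * Real.pi * x.1 := by ring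
      have e3 : 2 * Real.pi * (k * x.1 + (l + 1) * x.2) + c
          = 2 * Real.pi * (k * x.1 + l * x.2) + c + 2 * Real.pi * x.2 := by ring
      have e4 : 2 * Real.pi * (k * x.1 + (l - 1) * x.2) + c
          = 2 * Real.pi * (k * x.1 + l * x.2) + c - 2 * Real.pi * x.2 := by ring
      rw [e1, e2, e3, e4]
      generalize 2 * Real.pi * (k * x.1 + l * x.2) + c = A
      rw [Real.cos_add, Real.cos_sub, Real.cos_add, Real.cos_sub]
      ring
    simp only
    rw [h]
    exact sub_mem (sub_mem (Submodule.smul_mem _ _ (trigMonomial_mem _ _ _))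
      (Submodule.smul_mem _ _ (add_mem (trigMonomial_mem _ _ _) (trigMonomial_mem _ _ _))))
      (Submodule.smul_mem _ _ (add_mem (trigMonomial_mem _ _ _) (trigMonomial_mem _ _ _)))
  | zero => simp
  | add f g _ _ hf hg => rw [add_mul]; exact add_mem hf hg
  | smul a f _ hf => rw [smul_mul_assoc]; exact Submodule.smul_mem _ _ hf

theorem eval_cosSum_mem (P : Polynomial ℝ) :
    (fun x => P.eval (cosSum x)) ∈ trigPolynomials := by
  induction P using Polynomial.induction_on with
  | C a =>
    have : (fun x : ℝ × ℝ => (Polynomial.C a).eval (cosSum x)) = a • trigMonomial 0 0 0 := by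
      ext x; simp [trigMonomial]
    rw [this]
    exact Submodule.smul_mem _ _ (trigMonomial_mem _ _ _)
  | add p q hp hq =>
    have h := add_mem hp hq
    convert h using 1
    ext x; simp
  | monomial n a h =>
    convert mul_cosSum_mem h using 1
    ext x
    simp [pow_succ, mul_assoc]

theorem integral_cos_period {k : ℤ} (hk : k ≠ 0) (c : ℝ) :
    ∫ y in (-(1 / 2) : ℝ)..(1 / 2), Real.cos (2 * Real.pi * k * y + c) = 0 := by
  have h : 2 * Real.pi * (k : ℝ) ≠ 0 := by positivity
  rw [intervalIntegral.integral_comp_mul_add (fun x => Real.cos x) h c, integral_cos,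
    show 2 * Real.pi * (k : ℝ) * (1 / 2) + c
      = 2 * Real.pi * (k : ℝ) * (-(1 / 2)) + c + k * (2 * Real.pi) by ring,
    Real.sin_add_int_mul_two_pi, sub_self, smul_zero]

theorem continuous_trigMonomial (k l : ℤ) (c : ℝ) : Continuous (trigMonomial k l c) := by
  unfold trigMonomial; fun_prop

theorem integral_trigMonomial {k l : ℤ} (h : k ≠ 0 ∨ l ≠ 0) (c : ℝ) :
    ∫ x in cell, trigMonomial k l c x = 0 := by
  rw [integral_cell_eq (continuous_trigMonomial k l c)]
  by_cases hl : l = 0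
  · have hk : k ≠ 0 := h.resolve_right (not_not.2 hl)
    subst hl
    have h1 : ∀ x y : ℝ, trigMonomial k 0 c (x, y) = Real.cos (2 * Real.pi * k * x + c) := by
      intro x y; simp [trigMonomial, mul_assoc]
    simp_rw [h1, intervalIntegral.integral_const]
    rw [intervalIntegral.integral_smul, integral_cos_period hk, smul_zero]
  · have h1 : ∀ x y : ℝ, trigMonomial k l c (x, y)
        = Real.cos (2 * Real.pi * l * y + (2 * Real.pi * k * x + c)) := by
      intro x y; simp only [trigMonomial]; ring_nf
    simp_rw [h1, integral_cos_period hl]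
    simp

/-- Along a non-resonant line, a trigonometric polynomial minus its mean has a bounded primitive. -/
theorem exists_bounded_primitive {ξ : ℝ × ℝ} (hξ : NonResonant ξ) (θ : ℝ) {f : ℝ × ℝ → ℝ}
    (hf : f ∈ trigPolynomials) :
    Continuous f ∧ ∃ W : ℝ → ℝ, (∃ C, ∀ x, |W x| ≤ C) ∧
      ∀ x, HasDerivAt W (f (ξ.1 * x - θ, ξ.2 * x - θ) - ∫ y in cell, f y) x := by
  induction hf using Submodule.span_induction with
  | mem f hf =>
    obtain ⟨⟨k, l, c⟩, rfl⟩ := hf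
    refine ⟨continuous_trigMonomial k l c, ?_⟩
    by_cases h0 : k = 0 ∧ l = 0
    · obtain ⟨rfl, rfl⟩ := h0
      refine ⟨fun _ => 0, ⟨0, by simp⟩, fun x => ?_⟩
      simpa [trigMonomial] using hasDerivAt_const x (0 : ℝ)
    -- Non-resonance enters here: along the line the monomial oscillates with nonzero frequency, so
    -- its primitive is a bounded sine.
    have h1 : (k : ℝ) * ξ.1 + (l : ℝ) * ξ.2 ≠ 0 :=
      hξ (k, l) fun h => h0 (by simpa [Prod.ext_iff] using h)
    set a : ℝ := 2 * Real.pi * (k * ξ.1 + l * ξ.2) with ha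
    set d : ℝ := c - 2 * Real.pi * (k * θ + l * θ) with hd
    have ha0 : a ≠ 0 := mul_ne_zero (by positivity) h1
    refine ⟨fun x => a⁻¹ * Real.sin (a * x + d), ⟨|a⁻¹|, fun x => ?_⟩, fun x => ?_⟩
    · rw [abs_mul]
      exact mul_le_of_le_one_right (abs_nonneg _) (Real.abs_sin_le_one _)
    · have h2 : HasDerivAt (fun x => a⁻¹ * Real.sin (a * x + d))
          (a⁻¹ * (Real.cos (a * x + d) * a)) x := by
        have := (((hasDerivAt_id x).const_mul a).add_const d).sin.const_mul a⁻¹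
        simpa using this
      have h3 := not_and_or.1 h0
      simp only
      rw [integral_trigMonomial h3, sub_zero]
      convert h2 using 1
      rw [trigMonomial]
      have h4 : 2 * Real.pi * (k * (ξ.1 * x - θ) + l * (ξ.2 * x - θ)) + c = a * x + d := by
        rw [ha, hd]; ring
      rw [h4]
      field_simp
  | zero =>
    refine ⟨continuous_const, fun _ => 0, ⟨0, by simp⟩, fun x => ?_⟩
    simpa using hasDerivAt_const x (0 : ℝ)
  | add f g _ _ hf hg =>
    obtain ⟨hfc, W, ⟨C, hC⟩, hW⟩ := hf
    obtain ⟨hgc, W', ⟨C', hC'⟩, hW'⟩ := hg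
    refine ⟨hfc.add hgc, fun x => W x + W' x, ⟨C + C', fun x =>
      (abs_add_le _ _).trans (add_le_add (hC x) (hC' x))⟩, fun x => ?_⟩
    refine ((hW x).fun_add (hW' x)).congr_deriv ?_
    have e : ∫ y in cell, (f + g) y = (∫ y in cell, f y) + ∫ y in cell, g y :=
      integral_add (hfc.continuousOn.integrableOn_compact isCompact_cell)
        (hgc.continuousOn.integrableOn_compact isCompact_cell)
    rw [e, Pi.add_apply]
    ring
  | smul a f _ hf =>
    obtain ⟨hfc, W, ⟨C, hC⟩, hW⟩ := hf
    refine ⟨hfc.const_smul a, fun x => a * W x, ⟨|a| * C, fun x => ?_⟩, fun x => ?_⟩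
    · rw [abs_mul]; exact mul_le_mul_of_nonneg_left (hC x) (abs_nonneg a)
    · refine ((hW x).const_mul a).congr_deriv ?_
      have e : ∫ y in cell, (a • f) y = a * ∫ y in cell, f y := integral_const_mul a f
      rw [e, Pi.smul_apply, smul_eq_mul]
      ring

/-- The mean of `h (2 - cos 2πx₁ - cos 2πx₂)` over the torus. -/
noncomputable def cosMean (h : ℝ → ℝ) : ℝ := ∫ x in cell, h (cosSum x)

/-- Along a non-resonant line, `h (cosSum)` minus its mean is uniformly close to the derivative
of a bounded `C¹` function. -/
theorem exists_approximate_primitive {ξ : ℝ × ℝ} (hξ : NonResonant ξ) (θ : ℝ) {h : ℝ → ℝ}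
    (hh : Continuous h) {ε : ℝ} (hε : 0 < ε) :
    ∃ W : ℝ → ℝ, ContDiff ℝ 1 W ∧ (∃ C, ∀ x, |W x| ≤ C) ∧
      ∀ x, |deriv W x - (h (cosSum (ξ.1 * x - θ, ξ.2 * x - θ)) - cosMean h)| ≤ ε := by
  -- The integrand depends on the torus variable only through `cosSum`, with values in `[0, 4]`, so
  -- one-variable Weierstrass approximation suffices.
  obtain ⟨P, hP⟩ := exists_polynomial_near_of_continuousOn 0 4 h hh.continuousOn (ε / 2)
    (by positivity)
  have hP' : ∀ x, |P.eval (cosSum x) - h (cosSum x)| ≤ ε / 2 := fun x =>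
    (hP _ ⟨cosSum_nonneg x, cosSum_le_four x⟩).le
  obtain ⟨hc, W, hWb, hW⟩ := exists_bounded_primitive hξ θ (eval_cosSum_mem P)
  have hd : deriv W = fun x => P.eval (cosSum (ξ.1 * x - θ, ξ.2 * x - θ)) -
      ∫ y in cell, P.eval (cosSum y) := funext fun x => (hW x).deriv
  have hmean : |(∫ y in cell, P.eval (cosSum y)) - cosMean h| ≤ ε / 2 := by
    have hhc : Continuous fun x => h (cosSum x) := hh.comp continuous_cosSum
    rw [cosMean, ← integral_sub (hc.continuousOn.integrableOn_compact isCompact_cell)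
      (hhc.continuousOn.integrableOn_compact isCompact_cell)]
    have := norm_integral_le_of_norm_le_const (μ := volume.restrict cell)
      (f := fun x => P.eval (cosSum x) - h (cosSum x)) (C := ε / 2)
      (Eventually.of_forall hP')
    simpa using this
  refine ⟨W, contDiff_one_iff_deriv.2 ⟨fun x => (hW x).differentiableAt, ?_⟩, hWb, fun x => ?_⟩
  · rw [hd]
    have : Continuous fun x : ℝ => (ξ.1 * x - θ, ξ.2 * x - θ) := by fun_prop
    exact (hc.comp this).sub continuous_const
  · rw [hd]
    have h1 := abs_le.1 (hP' (ξ.1 * x - θ, ξ.2 * x - θ))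
    have h2 := abs_le.1 hmean
    simp only
    rw [abs_le]
    constructor <;> linarith

/-- The point is taken in the open ball so that a neighbourhood of it inside `cell` has positive
measure. -/
theorem cosMean_pos {h : ℝ → ℝ} (hh : Continuous h) (h0 : ∀ t, 0 ≤ h t) {x : ℝ × ℝ}
    (hx : x ∈ Metric.ball (0 : ℝ × ℝ) (1 / 2)) (hpos : 0 < h (cosSum x)) : 0 < cosMean h := by
  have hc : Continuous fun x => h (cosSum x) := hh.comp continuous_cosSum
  rw [cosMean, setIntegral_pos_iff_support_of_nonneg_ae (Eventually.of_forall fun x => h0 _)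
    (hc.continuousOn.integrableOn_compact isCompact_cell)]
  have h1 : 0 < volume (Function.support (fun x => h (cosSum x)) ∩ Metric.ball (0 : ℝ × ℝ) (1 / 2)) :=
    (hc.isOpen_support.inter Metric.isOpen_ball).measure_pos _ ⟨x, hpos.ne', hx⟩
  exact h1.trans_le (measure_mono (inter_subset_inter_right _ Metric.ball_subset_closedBall))

/-! ### Identification of the effective Hamiltonian. -/

/-- The values of `cosSum` along a line of slope `ξ`. -/
noncomputable def cosLine (ξ : ℝ × ℝ) (θ x : ℝ) : ℝ := cosSum (ξ.1 * x - θ, ξ.2 * x - θ)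

/-- The speed `√(2(μ + t^γ))` at energy `μ`. -/
noncomputable def speed (γ μ t : ℝ) : ℝ := √(2 * (μ + t ^ γ))

/-- The momentum `∫ √(2(μ + U))` at energy `μ`. -/
noncomputable def momentum (γ μ : ℝ) : ℝ := cosMean (speed γ μ)

theorem continuous_cosLine (ξ : ℝ × ℝ) (θ : ℝ) : Continuous (cosLine ξ θ) := by
  unfold cosLine
  exact continuous_cosSum.comp (by fun_prop)

theorem cosLine_nonneg (ξ : ℝ × ℝ) (θ x : ℝ) : 0 ≤ cosLine ξ θ x := cosSum_nonneg _

theorem cosLine_le_four (ξ : ℝ × ℝ) (θ x : ℝ) : cosLine ξ θ x ≤ 4 := cosSum_le_four _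

section

variable {γ μ : ℝ}

theorem continuous_speed (hγ : 0 < γ) : Continuous (speed γ μ) := by
  unfold speed
  have := Real.continuous_rpow_const (q := γ) hγ.le
  fun_prop

theorem speed_nonneg (t : ℝ) : 0 ≤ speed γ μ t := Real.sqrt_nonneg _

theorem speed_sq (hμ : 0 ≤ μ) {t : ℝ} (ht : 0 ≤ t) : speed γ μ t ^ 2 / 2 = μ + t ^ γ := by
  have := Real.rpow_nonneg ht γ
  rw [speed, Real.sq_sqrt (by positivity)]
  ring

theorem speed_le (hγ : 0 < γ) {t : ℝ} (ht : 0 ≤ t) (ht4 : t ≤ 4) :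
    speed γ μ t ≤ √(2 * (μ + 4 ^ γ)) := by
  have := Real.rpow_le_rpow ht ht4 hγ.le
  exact Real.sqrt_le_sqrt (by linarith)

theorem momentum_pos (hγ : 0 < γ) (hμ : 0 ≤ μ) : 0 < momentum γ μ := by
  refine cosMean_pos (x := (1 / 4, 1 / 4)) (continuous_speed hγ) speed_nonneg ?_ ?_
  · rw [Metric.mem_ball, dist_zero_right, Prod.norm_def]
    norm_num [Real.norm_eq_abs, abs_of_pos]
  · have h : cosSum (1 / 4, 1 / 4) = 2 := by
      have : 2 * Real.pi * (1 / 4) = Real.pi / 2 := by ring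
      simp only [cosSum, this, Real.cos_pi_div_two]
      norm_num
    rw [h, speed]
    positivity

/-- Factoring `r² - s²` turns an error `η` in the slope into an error `η(L + 1)` in the energy. -/
theorem abs_half_sq_sub_le {s r L η δ : ℝ} (hs : 0 ≤ s) (hsL : s ≤ L) (hη : η ≤ 1)
    (hδ : η * (L + 1) ≤ δ) (h : |r - s| ≤ η) : |r ^ 2 / 2 - s ^ 2 / 2| ≤ δ := by
  have hη0 : 0 ≤ η := (abs_nonneg _).trans h
  have h1 : |r + s| ≤ 2 * (L + 1) := by
    obtain ⟨h2, h3⟩ := abs_le.1 h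
    rw [abs_le]; constructor <;> linarith
  have h2 : r ^ 2 / 2 - s ^ 2 / 2 = (r - s) * (r + s) / 2 := by ring
  rw [h2, abs_div, abs_mul, abs_two]
  have h3 := mul_le_mul h h1 (abs_nonneg _) hη0
  linarith

variable {ξ : ℝ × ℝ} {θ : ℝ}

/-- Take `ψ = tW` with `W'` close to speed minus mean. For `p = t * momentum γ μ`, the choice `|t| =
1` gives approximate solutions, and `|t| ≤ 1` still gives approximate subsolutions because scaling
down lowers the kinetic energy. -/
theorem exists_contDiff_corrector (hγ : 0 < γ) (hξ : NonResonant ξ) (θ t : ℝ) {η : ℝ}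
    (hη : 0 < η) :
    ∃ ψ : ℝ → ℝ, ContDiff ℝ 1 ψ ∧ (∃ C, ∀ x, |ψ x| ≤ C) ∧ ∀ x, ∃ r,
      t * momentum γ μ + deriv ψ x = t * r ∧ |r - speed γ μ (cosLine ξ θ x)| ≤ η := by
  obtain ⟨W, hW, ⟨C, hC⟩, hd⟩ :=
    exists_approximate_primitive hξ θ (continuous_speed (μ := μ) hγ) hη
  refine ⟨fun x => t * W x, contDiff_const.mul hW, ⟨|t| * C, fun x => ?_⟩, fun x =>
    ⟨momentum γ μ + deriv W x, ?_, ?_⟩⟩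
  · rw [abs_mul]; exact mul_le_mul_of_nonneg_left (hC x) (abs_nonneg _)
  · rw [deriv_const_mul _ (hW.differentiable one_ne_zero x)]; ring
  · refine le_of_eq_of_le ?_ (hd x)
    simp only [momentum, cosLine]
    congr 1
    ring

/-- The mechanical Hamiltonian with potential `-(cosLine)^γ`. -/
noncomputable def lineHamiltonian (γ : ℝ) (ξ : ℝ × ℝ) (θ : ℝ) : ℝ → ℝ → ℝ :=
  mechanicalHamiltonian fun x => -cosLine ξ θ x ^ γ

theorem lineHamiltonian_eq (hμ : 0 ≤ μ) (x q : ℝ) :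
    lineHamiltonian γ ξ θ x q = μ + (q ^ 2 / 2 - speed γ μ (cosLine ξ θ x) ^ 2 / 2) := by
  rw [speed_sq hμ (cosLine_nonneg _ _ _), lineHamiltonian, mechanicalHamiltonian, sq_abs]
  ring

/-- The factor `2` pays for two errors of size `η`: that of the approximate corrector and that of
the penalty in the comparison. -/
theorem exists_tolerance (L : ℝ) (hL : 0 ≤ L) {δ : ℝ} (hδ : 0 < δ) :
    ∃ η, 0 < η ∧ 2 * η ≤ 1 ∧ 2 * η * (L + 1) ≤ δ := by
  refine ⟨min 1 (δ / (L + 1)) / 2, by positivity, by linarith [min_le_left 1 (δ / (L + 1))], ?_⟩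
  have h := min_le_right 1 (δ / (L + 1))
  have : 0 < L + 1 := by linarith
  rw [le_div_iff₀ this] at h
  linarith

theorem isCellConstant_of_abs_eq (hγ : 0 < γ) (hξ : NonResonant ξ) (hμ : 0 ≤ μ) {p : ℝ}
    (hp : |p| = momentum γ μ) : IsCellConstant (lineHamiltonian γ ξ θ) p μ := by
  intro δ hδ
  obtain ⟨η, hη, hη1, hηδ⟩ := exists_tolerance _ (Real.sqrt_nonneg (2 * (μ + 4 ^ γ))) hδ
  obtain ⟨t, ht, hpt⟩ : ∃ t : ℝ, t ^ 2 = 1 ∧ p = t * momentum γ μ := by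
    rcases abs_choice p with h | h
    · exact ⟨1, by norm_num, by linarith⟩
    · exact ⟨-1, by norm_num, by linarith⟩
  obtain ⟨ψ, hψ, ⟨C, hC⟩, hr⟩ := exists_contDiff_corrector (μ := μ) hγ hξ θ t hη
  have hH : ∀ x, |lineHamiltonian γ ξ θ x (p + deriv ψ x) - μ| ≤ δ := by
    intro x
    obtain ⟨r, h1, h2⟩ := hr x
    rw [lineHamiltonian_eq hμ, hpt, h1, mul_pow, ht, one_mul, add_sub_cancel_left]
    exact abs_half_sq_sub_le (speed_nonneg _)
      (speed_le hγ (cosLine_nonneg _ _ _) (cosLine_le_four _ _ _)) hη1 hηδ (by linarith)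
  have hd : ∀ x, ‖deriv ψ x‖ ≤ |t| * (√(2 * (μ + 4 ^ γ)) + η) + |p| := by
    intro x
    obtain ⟨r, h1, h2⟩ := hr x
    have h3 : |r| ≤ √(2 * (μ + 4 ^ γ)) + η := by
      have h4 := abs_le.1 h2
      have h5 := speed_nonneg (γ := γ) (μ := μ) (cosLine ξ θ x)
      have h6 := speed_le (μ := μ) hγ (cosLine_nonneg ξ θ x) (cosLine_le_four ξ θ x)
      rw [abs_le]; constructor <;> linarith
    rw [show deriv ψ x = t * r - p by linarith, Real.norm_eq_abs]
    refine (abs_sub _ _).trans ?_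
    rw [abs_mul]
    exact add_le_add_left (mul_le_mul_of_nonneg_left h3 (abs_nonneg _)) _
  have hlip : LipschitzWith (|t| * (√(2 * (μ + 4 ^ γ)) + η) + |p|).toNNReal ψ :=
    lipschitzWith_of_nnnorm_deriv_le (hψ.differentiable one_ne_zero) fun x => by
      rw [← NNReal.coe_le_coe, coe_nnnorm, Real.coe_toNNReal _ (by positivity)]
      exact hd x
  refine ⟨ψ, ?_, hlip.uniformContinuous, ⟨_, hlip⟩,
    viscosityGE_of_contDiff hψ fun x => ?_, viscosityLE_of_contDiff hψ fun x => ?_⟩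
  · rw [isBounded_iff_forall_norm_le]
    exact ⟨C, by rintro _ ⟨x, rfl⟩; exact hC x⟩
  · linarith [(abs_le.1 (hH x)).1]
  · linarith [(abs_le.1 (hH x)).2]

theorem IsCellConstant.exists_bounded {H : ℝ → ℝ → ℝ} {p c δ : ℝ} (h : IsCellConstant H p c)
    (hδ : 0 < δ) : ∃ w : ℝ → ℝ, ∃ A, (∀ x, |w x| ≤ A) ∧ Continuous w ∧
      ViscosityGE (fun x q => H x (p + q)) (c - δ) w ∧
      ViscosityLE (fun x q => H x (p + q)) (c + δ) w := by
  obtain ⟨w, hb, hu, -, h1, h2⟩ := h δ hδ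
  obtain ⟨A, hA⟩ := isBounded_iff_forall_norm_le.1 hb
  exact ⟨w, A, fun x => hA _ ⟨x, rfl⟩, hu.continuous, h1, h2⟩

/-- An approximate corrector is a supersolution near level `c`; it is compared with the smooth
subsolution `tW`, which exists for every `|t| ≤ 1`. This is why `|p| ≤ momentum γ μ` is enough. -/
theorem IsCellConstant.le_energy (hγ : 0 < γ) (hξ : NonResonant ξ) (hμ : 0 ≤ μ) {p c : ℝ}
    (hp : |p| ≤ momentum γ μ) (hc : IsCellConstant (lineHamiltonian γ ξ θ) p c) : c ≤ μ := by
  have hm := momentum_pos hγ hμ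
  refine le_of_forall_pos_le_add fun δ hδ => ?_
  obtain ⟨η, hη, hη1, hηδ⟩ := exists_tolerance _ (Real.sqrt_nonneg (2 * (μ + 4 ^ γ))) (half_pos hδ)
  obtain ⟨t, ht, hpt⟩ : ∃ t : ℝ, |t| ≤ 1 ∧ p = t * momentum γ μ :=
    ⟨p / momentum γ μ, by rw [abs_div, abs_of_pos hm]; exact (div_le_one hm).2 hp, by field_simp⟩
  obtain ⟨ψ, hψ, ⟨C, hC⟩, hr⟩ := exists_contDiff_corrector (μ := μ) hγ hξ θ t hη
  obtain ⟨w, A, hA, hwc, hGE, -⟩ := IsCellConstant.exists_bounded hc (half_pos hδ)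
  have key : c - δ / 2 ≤ μ + δ / 2 := by
    refine ViscosityGE.le_of_contDiff hGE hwc hψ hη (A := A + C)
      (fun x => (abs_sub _ _).trans (add_le_add (hA x) (hC x))) fun x q hq => ?_
    obtain ⟨r, h1, h2⟩ := hr x
    rw [lineHamiltonian_eq hμ]
    set s := speed γ μ (cosLine ξ θ x)
    have hs : 0 ≤ s := speed_nonneg _
    have hq' : |p + q| ≤ s + 2 * η := by
      have h3 : p + q = t * r + (q - deriv ψ x) := by linarith
      have h4 : |t * r| ≤ |r| := by rw [abs_mul]; exact mul_le_of_le_one_left (abs_nonneg _) ht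
      have h5 : |r| ≤ s + η := by
        have := abs_le.1 h2
        rw [abs_le]; constructor <;> linarith
      rw [h3]
      refine (abs_add_le _ _).trans ?_
      linarith
    have h6 := abs_half_sq_sub_le hs (speed_le hγ (cosLine_nonneg _ _ _) (cosLine_le_four _ _ _))
      hη1 hηδ (r := s + 2 * η) (by rw [add_sub_cancel_left, abs_of_pos]; positivity)
    have h7 : (p + q) ^ 2 ≤ (s + 2 * η) ^ 2 := sq_le_sq.2 (hq'.trans (le_abs_self _))
    linarith [(abs_le.1 h6).2]
  linarith

/-- Here the smooth function must be an approximate supersolution, which requires `|t| = 1`. -/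
theorem IsCellConstant.energy_le (hγ : 0 < γ) (hξ : NonResonant ξ) (hμ : 0 ≤ μ) {p c : ℝ}
    (hp : |p| = momentum γ μ) (hc : IsCellConstant (lineHamiltonian γ ξ θ) p c) : μ ≤ c := by
  refine le_of_forall_pos_le_add fun δ hδ => ?_
  obtain ⟨η, hη, hη1, hηδ⟩ := exists_tolerance _ (Real.sqrt_nonneg (2 * (μ + 4 ^ γ))) (half_pos hδ)
  obtain ⟨t, ht, hpt⟩ : ∃ t : ℝ, (t = 1 ∨ t = -1) ∧ p = t * momentum γ μ := by
    rcases abs_choice p with h | h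
    · exact ⟨1, by norm_num, by linarith⟩
    · exact ⟨-1, by norm_num, by linarith⟩
  have ht1 : |t| = 1 := by rcases ht with rfl | rfl <;> simp
  have htt : t * t = 1 := by rcases ht with rfl | rfl <;> simp
  obtain ⟨ψ, hψ, ⟨C, hC⟩, hr⟩ := exists_contDiff_corrector (μ := μ) hγ hξ θ t hη
  obtain ⟨w, A, hA, hwc, -, hLE⟩ := IsCellConstant.exists_bounded hc (half_pos hδ)
  have key : μ - δ / 2 ≤ c + δ / 2 := by
    refine ViscosityLE.le_of_contDiff hLE hwc hψ hη (A := A + C)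
      (fun x => (abs_sub _ _).trans (add_le_add (hA x) (hC x))) fun x q hq => ?_
    obtain ⟨r, h1, h2⟩ := hr x
    rw [lineHamiltonian_eq hμ]
    set s := speed γ μ (cosLine ξ θ x)
    have hs : 0 ≤ s := speed_nonneg _
    -- Multiplying by `t = ±1` removes the sign, so that the slope can be compared with the positive
    -- speed.
    have h3 : t * (p + q) = r + t * (q - deriv ψ x) := by
      have : p + q = t * r + (q - deriv ψ x) := by linarith
      rw [this, mul_add, ← mul_assoc, htt, one_mul]
    have h4 : |t * (p + q) - s| ≤ 2 * η := by
      rw [h3, add_sub_right_comm]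
      refine (abs_add_le _ _).trans ?_
      rw [abs_mul, ht1, one_mul]
      linarith
    have h5 := abs_half_sq_sub_le hs (speed_le hγ (cosLine_nonneg _ _ _) (cosLine_le_four _ _ _))
      hη1 hηδ h4
    rw [mul_pow, sq t, htt, one_mul] at h5
    linarith [(abs_le.1 h5).1]
  linarith

/-- The bump `max 0 (ε - t)` has positive mean. If it vanished along a segment of length `2T`, its
bounded approximate primitive would fall there at rate at least half the mean; `T` is chosen so that
the total fall `2C + mean` exceeds the possible oscillation `2C`. -/
theorem exists_cosLine_lt (hξ : NonResonant ξ) (θ : ℝ) {ε : ℝ} (hε : 0 < ε) :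
    ∃ T, ∀ x, ∃ z, |x - z| ≤ T ∧ cosLine ξ θ z < ε := by
  set h : ℝ → ℝ := fun t => max 0 (ε - t) with hh
  have hc : Continuous h := by fun_prop
  have hm : 0 < cosMean h := by
    refine cosMean_pos (x := 0) hc (fun t => le_max_left _ _) (by simp) ?_
    have : cosSum 0 = 0 := by norm_num [cosSum]
    simp [hh, this, hε]
  obtain ⟨W, hW, ⟨C, hC⟩, hd⟩ := exists_approximate_primitive hξ θ hc (half_pos hm)
  have hC0 : 0 ≤ C := (abs_nonneg _).trans (hC 0)
  set T : ℝ := 2 * C / cosMean h + 1 with hT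
  have hT0 : 0 < T := by positivity
  refine ⟨T, fun x => ?_⟩
  by_contra! hno
  have hderiv : ∀ y ∈ interior (Icc (x - T) (x + T)), deriv W y ≤ -(cosMean h / 2) := by
    intro y hy
    have hy' := interior_subset hy
    have h1 : ε ≤ cosLine ξ θ y := hno y (by rw [abs_le]; constructor <;> linarith [hy'.1, hy'.2])
    have h2 := (abs_le.1 (hd y)).2
    have h3 : h (cosSum (ξ.1 * y - θ, ξ.2 * y - θ)) = 0 := by
      simp only [hh]
      exact max_eq_left (by unfold cosLine at h1; linarith)
    rw [h3] at h2
    linarith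
  have h1 := (convex_Icc (x - T) (x + T)).image_sub_le_mul_sub_of_deriv_le
    hW.continuous.continuousOn (hW.differentiable one_ne_zero).differentiableOn hderiv
    (x - T) (by constructor <;> linarith) (x + T) (by constructor <;> linarith) (by linarith)
  have h2 := abs_le.1 (hC (x + T))
  have h3 := abs_le.1 (hC (x - T))
  have h4 : cosMean h * T = 2 * C + cosMean h := by rw [hT]; field_simp
  nlinarith

/-- The potential comes arbitrarily close to `0` along the line. Testing the subsolution near such a
point leaves a nonnegative kinetic term and an arbitrarily small potential. -/
theorem IsCellConstant.nonneg (hγ : 0 < γ) (hξ : NonResonant ξ) {p c : ℝ}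
    (hc : IsCellConstant (lineHamiltonian γ ξ θ) p c) : 0 ≤ c := by
  refine le_of_forall_pos_le_add fun δ hδ => ?_
  obtain ⟨w, A, hA, hwc, -, hLE⟩ := IsCellConstant.exists_bounded hc (half_pos hδ)
  obtain ⟨T, hT⟩ := exists_cosLine_lt hξ θ (Real.rpow_pos_of_pos (half_pos hδ) (1 / γ))
  obtain ⟨z, -, hz⟩ := hT 0
  obtain ⟨r, hr, hball⟩ := Metric.eventually_nhds_iff.1
    ((continuous_cosLine ξ θ).continuousAt.eventually_lt_const hz)
  obtain ⟨x, q, hx, hq⟩ := ViscosityLE.exists_near hLE hwc hA z hr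
  have h1 := hball (y := x) (by rwa [Real.dist_eq])
  have h2 : cosLine ξ θ x ^ γ ≤ δ / 2 := by
    have := Real.rpow_le_rpow (cosLine_nonneg _ _ _) h1.le hγ.le
    rwa [← Real.rpow_mul (half_pos hδ).le, one_div_mul_cancel hγ.ne', Real.rpow_one] at this
  simp only [lineHamiltonian, mechanicalHamiltonian] at hq
  nlinarith [sq_nonneg |p + q|]

theorem isCellConstant_zero (hγ : 0 < γ) (hξ : NonResonant ξ) {p : ℝ}
    (hp : |p| < momentum γ 0) : IsCellConstant (lineHamiltonian γ ξ θ) p 0 := by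
  intro δ hδ
  set s : ℝ → ℝ := fun x => speed γ 0 (cosLine ξ θ x) with hs
  have hsc : Continuous s := (continuous_speed hγ).comp (continuous_cosLine _ _)
  set S : ℝ → ℝ := fun x => ∫ t in (0 : ℝ)..x, s t
  have hS : ∀ x, HasDerivAt S (s x) x := fun x => hsc.integral_hasStrictDerivAt 0 x |>.hasDerivAt
  -- With half of the gap, the growth rate `momentum γ 0 - ε` of the critical distance still exceeds
  -- `|p|`.
  set ε : ℝ := (momentum γ 0 - |p|) / 2 with hε
  have hε0 : 0 < ε := by linarith
  obtain ⟨W, hW, ⟨C, hC⟩, hd⟩ :=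
    exists_approximate_primitive hξ θ (continuous_speed (μ := 0) hγ) hε0
  obtain ⟨T, hT⟩ := exists_cosLine_lt hξ θ (Real.rpow_pos_of_pos hδ (1 / γ))
  refine exists_approximateCorrector_zero (s := s) (S := S) (L := √(2 * (0 + 4 ^ γ)))
    (A := 2 * C) (c := momentum γ 0 - ε) (T := T) (fun x => speed_nonneg _)
    (fun x => speed_le hγ (cosLine_nonneg _ _ _) (cosLine_le_four _ _ _)) hsc hS (fun x => ?_) hδ
    (by linarith) (fun x z => ?_) (fun x => ?_)
  · simp only [hs]
    rw [speed_sq le_rfl (cosLine_nonneg _ _ _), zero_add]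
  · set D : ℝ → ℝ := fun x => W x - (S x - momentum γ 0 * x) with hD
    have hDd : ∀ x, HasDerivAt D (deriv W x - (s x - momentum γ 0)) x := fun x => by
      have h1 : HasDerivAt (fun x => momentum γ 0 * x) (momentum γ 0) x := by
        simpa using (hasDerivAt_id x).const_mul (momentum γ 0)
      exact (hW.differentiable one_ne_zero x).hasDerivAt.fun_sub ((hS x).fun_sub h1)
    have h1 := Convex.norm_image_sub_le_of_norm_hasDerivWithin_le (C := ε)
      (s := univ) (x := z) (y := x) (fun x _ => (hDd x).hasDerivWithinAt)
      (fun x _ => hd x) convex_univ (mem_univ _) (mem_univ _)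
    rw [Real.norm_eq_abs, Real.norm_eq_abs] at h1
    have h2 : momentum γ 0 * (x - z) = (S x - S z) + ((D x - D z) + -(W x - W z)) := by
      simp only [hD]; ring
    have h3 : momentum γ 0 * |x - z| = |momentum γ 0 * (x - z)| := by
      rw [abs_mul, abs_of_pos (momentum_pos hγ le_rfl)]
    have h4 := abs_add_le (S x - S z) ((D x - D z) + -(W x - W z))
    have h5 := abs_add_le (D x - D z) (-(W x - W z))
    rw [abs_neg] at h5
    have h6 := (abs_sub (W x) (W z)).trans (add_le_add (hC x) (hC z))
    rw [← h2, ← h3] at h4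
    linarith
  · obtain ⟨z, hz, hz'⟩ := hT x
    refine ⟨z, hz, ?_⟩
    simp only [hs]
    rw [speed_sq le_rfl (cosLine_nonneg _ _ _), zero_add]
    have := Real.rpow_le_rpow (cosLine_nonneg _ _ _) hz'.le hγ.le
    rwa [← Real.rpow_mul hδ.le, one_div_mul_cancel hγ.ne', Real.rpow_one] at this

/-- Existence of a cell constant makes the `epsilon` choice a genuine one, and the two comparison
bounds identify it. -/
theorem effectiveHamiltonian_eq_energy (hγ : 0 < γ) (hξ : NonResonant ξ) (hμ : 0 ≤ μ) {p : ℝ}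
    (hp : |p| = momentum γ μ) : effectiveHamiltonian (lineHamiltonian γ ξ θ) p = μ := by
  have h : IsCellConstant (lineHamiltonian γ ξ θ) p
      (effectiveHamiltonian (lineHamiltonian γ ξ θ) p) :=
    Classical.epsilon_spec ⟨μ, isCellConstant_of_abs_eq hγ hξ hμ hp⟩
  exact le_antisymm (IsCellConstant.le_energy hγ hξ hμ hp.le h) (IsCellConstant.energy_le hγ hξ hμ hp h)

theorem effectiveHamiltonian_eq_zero (hγ : 0 < γ) (hξ : NonResonant ξ) {p : ℝ}
    (hp : |p| ≤ momentum γ 0) : effectiveHamiltonian (lineHamiltonian γ ξ θ) p = 0 := by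
  rcases hp.lt_or_eq with hp' | hp'
  · have h : IsCellConstant (lineHamiltonian γ ξ θ) p
        (effectiveHamiltonian (lineHamiltonian γ ξ θ) p) :=
      Classical.epsilon_spec ⟨0, isCellConstant_zero hγ hξ hp'⟩
    exact le_antisymm (IsCellConstant.le_energy hγ hξ le_rfl hp h) (IsCellConstant.nonneg hγ hξ h)
  · exact effectiveHamiltonian_eq_energy hγ hξ le_rfl hp'

end

/-! ### Energy integrals and their size at small energy. -/

section

/-- With `cosSum_le_norm_sq` this compares `U` with `‖x‖^(2γ)`, reducing the energy integrals to
radial ones. Restriction to `cell` keeps the argument of the cosine in `[-π, π]`. -/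
theorem norm_sq_le_cosSum {x : ℝ × ℝ} (hx : x ∈ cell) : ‖x‖ ^ 2 ≤ cosSum x := by
  have hpi := Real.pi_pos
  have key : ∀ t : ℝ, |t| ≤ 1 / 2 → t ^ 2 ≤ 1 - Real.cos (2 * Real.pi * t) := by
    intro t ht
    have h1 := Real.cos_le_one_sub_mul_cos_sq (x := 2 * Real.pi * t) (by
      rw [abs_mul, abs_of_pos (by positivity)]
      nlinarith)
    have h2 : 2 / Real.pi ^ 2 * (2 * Real.pi * t) ^ 2 = 8 * t ^ 2 := by field_simp; ring
    nlinarith [sq_nonneg t]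
  have hn : ‖x‖ ≤ 1 / 2 := by simpa [cell] using hx
  have h1 := key x.1 ((norm_fst_le x).trans hn)
  have h2 := key x.2 ((norm_snd_le x).trans hn)
  have h3 : ‖x‖ ^ 2 ≤ x.1 ^ 2 + x.2 ^ 2 := by
    rw [Prod.norm_def]
    rcases max_choice ‖x.1‖ ‖x.2‖ with h | h <;> rw [h, Real.norm_eq_abs, sq_abs] <;>
      nlinarith [sq_nonneg x.1, sq_nonneg x.2]
  unfold cosSum
  linarith

theorem cosSum_le_norm_sq (x : ℝ × ℝ) : cosSum x ≤ 40 * ‖x‖ ^ 2 := by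
  have key : ∀ t : ℝ, 1 - Real.cos (2 * Real.pi * t) ≤ 20 * t ^ 2 := by
    intro t
    have h1 := Real.one_sub_sq_div_two_le_cos (x := 2 * Real.pi * t)
    have h2 : Real.pi ^ 2 ≤ 10 := by nlinarith [Real.pi_lt_d2, Real.pi_pos]
    nlinarith [mul_le_mul_of_nonneg_right h2 (sq_nonneg t)]
  have h1 := key x.1
  have h2 := key x.2
  have h3 := pow_le_pow_left₀ (norm_nonneg _) (norm_fst_le x) 2
  have h4 := pow_le_pow_left₀ (norm_nonneg _) (norm_snd_le x) 2
  rw [Real.norm_eq_abs, sq_abs] at h3 h4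
  unfold cosSum
  linarith

/-- `∫ (μ + U)^a` over the torus. -/
noncomputable def energyIntegral (γ a μ : ℝ) : ℝ := cosMean fun t => (μ + t ^ γ) ^ a

variable {γ μ a : ℝ}

theorem continuous_cosSum_rpow (hγ : 0 < γ) : Continuous fun x => cosSum x ^ γ :=
  continuous_cosSum.rpow_const fun _ => Or.inr hγ.le

theorem cosSum_rpow_nonneg (x : ℝ × ℝ) : 0 ≤ cosSum x ^ γ := Real.rpow_nonneg (cosSum_nonneg x) _

theorem cosSum_rpow_le (hγ : 0 < γ) (x : ℝ × ℝ) : cosSum x ^ γ ≤ 4 ^ γ :=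
  Real.rpow_le_rpow (cosSum_nonneg x) (cosSum_le_four x) hγ.le

theorem continuous_energy_rpow (hγ : 0 < γ) (hμ : 0 < μ) (a : ℝ) :
    Continuous fun x => (μ + cosSum x ^ γ) ^ a :=
  (continuous_const.add (continuous_cosSum_rpow hγ)).rpow_const fun x =>
    Or.inl (add_pos_of_pos_of_nonneg hμ (cosSum_rpow_nonneg x)).ne'

theorem integrableOn_energy_rpow (hγ : 0 < γ) (hμ : 0 < μ) (a : ℝ) :
    IntegrableOn (fun x => (μ + cosSum x ^ γ) ^ a) cell :=
  (continuous_energy_rpow hγ hμ a).continuousOn.integrableOn_compact isCompact_cell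

theorem hasDerivAt_energyIntegral (hγ : 0 < γ) (hμ : 0 < μ) (a : ℝ) :
    HasDerivAt (energyIntegral γ a) (a * energyIntegral γ (a - 1) μ) μ := by
  have hmem : Ioo (μ / 2) (2 * μ) ∈ 𝓝 μ := Ioo_mem_nhds (by linarith) (by linarith)
  set F' : ℝ → ℝ × ℝ → ℝ := fun m x => a * (m + cosSum x ^ γ) ^ (a - 1) with hF'
  obtain ⟨B, hB⟩ : ∃ B, ∀ m ∈ Icc (μ / 2) (2 * μ), ∀ v ∈ Icc (0 : ℝ) (4 ^ γ),
      ‖a * (m + v) ^ (a - 1)‖ ≤ B := by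
    have hcont : ContinuousOn (fun z : ℝ × ℝ => a * (z.1 + z.2) ^ (a - 1))
        (Icc (μ / 2) (2 * μ) ×ˢ Icc (0 : ℝ) (4 ^ γ)) := by
      refine continuousOn_const.mul (ContinuousOn.rpow_const (by fun_prop) fun z hz => Or.inl ?_)
      have h1 := hz.1.1
      have h2 := hz.2.1
      linarith
    obtain ⟨B, hB⟩ := (isCompact_Icc.prod isCompact_Icc).exists_bound_of_continuousOn hcont
    exact ⟨B, fun m hm v hv => hB (m, v) ⟨hm, hv⟩⟩
  have h := (hasDerivAt_integral_of_dominated_loc_of_deriv_le (μ := volume.restrict cell)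
    (F := fun m x => (m + cosSum x ^ γ) ^ a) (F' := F') (bound := fun _ => B) hmem
    (by
      filter_upwards [hmem] with m hm
      exact (continuous_energy_rpow hγ (by linarith [hm.1]) a).aestronglyMeasurable)
    (integrableOn_energy_rpow hγ hμ a)
    (continuous_const.mul (continuous_energy_rpow hγ hμ (a - 1))).aestronglyMeasurable
    (Eventually.of_forall fun x m hm => hB m (Ioo_subset_Icc_self hm) _
      ⟨cosSum_rpow_nonneg x, cosSum_rpow_le hγ x⟩)
    (integrable_const B)
    (Eventually.of_forall fun x m hm => by
      have hm0 : 0 < m + cosSum x ^ γ :=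
        add_pos_of_pos_of_nonneg (by linarith [hm.1]) (cosSum_rpow_nonneg x)
      have := ((hasDerivAt_id m).add_const (cosSum x ^ γ)).rpow_const (p := a) (Or.inl hm0.ne')
      simpa [hF'] using this)).2
  refine h.congr_deriv ?_
  exact integral_const_mul a _

theorem energyIntegral_le (hγ : 0 < γ) (hμ : 0 < μ) (ha : a ≤ 0) :
    energyIntegral γ a μ ≤ μ ^ a := by
  have h : ∫ _ in cell, μ ^ a = μ ^ a := by simp
  rw [← h, energyIntegral, cosMean]
  refine integral_mono (integrableOn_energy_rpow hγ hμ a) (integrable_const _) fun x => ?_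
  exact Real.rpow_le_rpow_of_nonpos hμ (by linarith [cosSum_rpow_nonneg (γ := γ) x]) ha

theorem le_energyIntegral (hγ : 0 < γ) (hμ : 0 < μ) (ha : a ≤ 0) :
    (μ + 4 ^ γ) ^ a ≤ energyIntegral γ a μ := by
  have h : ∫ _ in cell, (μ + 4 ^ γ : ℝ) ^ a = (μ + 4 ^ γ : ℝ) ^ a := by simp
  rw [← h, energyIntegral, cosMean]
  refine integral_mono (integrable_const _) (integrableOn_energy_rpow hγ hμ a) fun x => ?_
  exact Real.rpow_le_rpow_of_nonpos (by linarith [cosSum_rpow_nonneg (γ := γ) x])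
    (by linarith [cosSum_rpow_le hγ x]) ha

theorem energyIntegral_nonneg (hμ : 0 < μ) : 0 ≤ energyIntegral γ a μ :=
  integral_nonneg fun x => Real.rpow_nonneg (by linarith [cosSum_rpow_nonneg (γ := γ) x]) _

/-- A nonpositive exponent reverses `‖x‖^(2γ) ≤ U`. The origin is excluded because a singular
majorant such as `‖x‖^(-(3γ))` takes the default value `0` there. -/
theorem energyIntegral_le_norm (hγ : 0 < γ) (hμ : 0 < μ) {f : ℝ × ℝ → ℝ} (ha : a ≤ 0)
    (hf : IntegrableOn f cell)
    (h : ∀ x ∈ cell, x ≠ 0 → (μ + ‖x‖ ^ (2 * γ)) ^ a ≤ f x) :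
    energyIntegral γ a μ ≤ ∫ x in cell, f x := by
  refine setIntegral_mono_ae_restrict (integrableOn_energy_rpow hγ hμ a) hf ?_
  have hne : ∀ᵐ x ∂(volume.restrict cell), x ≠ (0 : ℝ × ℝ) := by
    refine ae_restrict_of_ae ?_
    simp [ae_iff]
  filter_upwards [ae_restrict_mem measurableSet_cell, hne] with x hx hx0
  refine le_trans ?_ (h x hx hx0)
  refine Real.rpow_le_rpow_of_nonpos
    (add_pos_of_pos_of_nonneg hμ (Real.rpow_nonneg (norm_nonneg x) _)) ?_ ha
  have h1 := Real.rpow_le_rpow (by positivity) (norm_sq_le_cosSum hx) hγ.le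
  rw [← Real.rpow_natCast, ← Real.rpow_mul (norm_nonneg x)] at h1
  push_cast at h1
  linarith

theorem finrank_plane : Module.finrank ℝ (ℝ × ℝ) = 2 := by simp

/-- Upper bound for `∫ (μ + U)^(-3/2)` in the singular range. -/
theorem energyIntegral_le_of_gt (hγ : 2 / 3 < γ) :
    ∃ C, 0 ≤ C ∧ ∀ μ, 0 < μ → energyIntegral γ (-(3 / 2)) μ ≤ C * μ ^ (1 / γ - 3 / 2) := by
  have hγ0 : 0 < γ := by linarith
  set f : ℝ × ℝ → ℝ := fun y => (1 + ‖y‖ ^ (2 * γ)) ^ (-(3 / 2) : ℝ) with hf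
  have hfc : Continuous f := by
    have h1 : Continuous fun y : ℝ × ℝ => ‖y‖ ^ (2 * γ) :=
      continuous_norm.rpow_const fun _ => Or.inr (by positivity)
    exact (continuous_const.add h1).rpow_const fun y =>
      Or.inl (show 1 + ‖y‖ ^ (2 * γ) ≠ 0 by positivity)
  -- The decay `‖y‖^(-3γ)` is integrable at infinity in the plane because `3γ > 2`.
  have hfi : Integrable f := by
    have h1 : Integrable (fun y : ℝ × ℝ => (1 + ‖y‖) ^ (-(3 * γ))) :=
      integrable_one_add_norm (by rw [finrank_plane]; push_cast; linarith)
    refine (h1.const_mul ((2 ^ (-(2 * γ)) : ℝ) ^ (-(3 / 2) : ℝ))).mono' hfc.aestronglyMeasurable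
      (Eventually.of_forall fun y => ?_)
    have h2 : (2 : ℝ) ^ (-(2 * γ)) * (1 + ‖y‖) ^ (2 * γ) ≤ 1 + ‖y‖ ^ (2 * γ) := by
      have h3 : (1 + ‖y‖) ^ (2 * γ) ≤ 2 ^ (2 * γ) * (1 + ‖y‖ ^ (2 * γ)) := by
        have hn := Real.rpow_nonneg (norm_nonneg y) (2 * γ)
        have h20 : (0 : ℝ) < 2 ^ (2 * γ) := by positivity
        rcases le_total ‖y‖ 1 with h | h
        · have := Real.rpow_le_rpow (z := 2 * γ) (by positivity) (show 1 + ‖y‖ ≤ 2 by linarith)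
            (by positivity)
          nlinarith
        · have := Real.rpow_le_rpow (z := 2 * γ) (by positivity)
            (show 1 + ‖y‖ ≤ 2 * ‖y‖ by linarith) (by positivity)
          rw [Real.mul_rpow (by norm_num) (norm_nonneg _)] at this
          nlinarith
      rw [Real.rpow_neg (by norm_num), inv_mul_le_iff₀ (by positivity)]
      exact h3
    rw [Real.norm_eq_abs, abs_of_nonneg (by simp only [hf]; positivity)]
    have h4 := Real.rpow_le_rpow_of_nonpos (z := -(3 / 2)) (by positivity) h2 (by norm_num)
    rw [Real.mul_rpow (by positivity) (by positivity), ← Real.rpow_mul (x := 1 + ‖y‖)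
      (by positivity)] at h4
    convert h4 using 3
    ring
  refine ⟨∫ y, f y, integral_nonneg fun y => by simp only [hf]; positivity, fun μ hμ => ?_⟩
  -- Substituting `x = Ry` turns `μ + ‖x‖^(2γ)` into `μ(1 + ‖y‖^(2γ))`; the Jacobian `R² = μ^(1/γ)`
  -- supplies the remaining power.
  set R : ℝ := μ ^ (1 / (2 * γ)) with hR
  have hR0 : 0 < R := by positivity
  have hRγ : R ^ (2 * γ) = μ := by
    rw [hR, ← Real.rpow_mul hμ.le, one_div_mul_cancel (by positivity), Real.rpow_one]
  have hscale : ∀ x : ℝ × ℝ, (μ + ‖x‖ ^ (2 * γ)) ^ (-(3 / 2) : ℝ)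
      = μ ^ (-(3 / 2) : ℝ) * f (R⁻¹ • x) := by
    intro x
    simp only [hf]
    rw [← Real.mul_rpow hμ.le (by positivity), norm_smul, Real.norm_eq_abs,
      abs_of_pos (inv_pos.2 hR0), Real.mul_rpow (by positivity) (norm_nonneg _),
      Real.inv_rpow hR0.le, hRγ]
    congr 1
    field_simp
  have hfi' : Integrable fun x : ℝ × ℝ => μ ^ (-(3 / 2) : ℝ) * f (R⁻¹ • x) :=
    (hfi.comp_smul (inv_ne_zero hR0.ne')).const_mul _
  calc energyIntegral γ (-(3 / 2)) μ
      ≤ ∫ x in cell, μ ^ (-(3 / 2) : ℝ) * f (R⁻¹ • x) :=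
        energyIntegral_le_norm hγ0 hμ (by norm_num) hfi'.integrableOn
          fun x _ _ => (hscale x).le
    _ ≤ ∫ x, μ ^ (-(3 / 2) : ℝ) * f (R⁻¹ • x) :=
        setIntegral_le_integral hfi' (Eventually.of_forall fun x => by
          simp only [hf, Pi.zero_apply]; positivity)
    _ = μ ^ (-(3 / 2) : ℝ) * (R ^ 2 * ∫ y, f y) := by
        rw [integral_const_mul, Measure.integral_comp_inv_smul_of_nonneg _ _ hR0.le, finrank_plane,
          smul_eq_mul]
    _ = _ := by
        have h1 : R ^ 2 = μ ^ (1 / γ) := by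
          rw [hR, ← Real.rpow_natCast, ← Real.rpow_mul hμ.le]
          congr 1
          push_cast
          field_simp
        rw [h1, sub_eq_add_neg, Real.rpow_add hμ]
        ring

/-- Upper bound for `∫ (μ + U)^(-3/2)` in the regular range. -/
theorem energyIntegral_le_of_lt (hγ0 : 0 < γ) (hγ : γ < 2 / 3) :
    ∃ C, 0 ≤ C ∧ ∀ μ, 0 < μ → energyIntegral γ (-(3 / 2)) μ ≤ C := by
  -- Now `3γ < 2`, so `μ` can be dropped altogether: the limiting singularity is integrable.
  have hint : IntegrableOn (fun x : ℝ × ℝ => ‖x‖ ^ (-(3 * γ))) cell := by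
    refine IntegrableOn.mono_set (t := Metric.ball (0 : ℝ × ℝ) 1) ?_
      (Metric.closedBall_subset_ball (by norm_num))
    refine integrableOn_ball_of_norm_le_rpow (C := 1) (α := 3 * γ) (by rw [finrank_plane]; norm_num)
      (by rw [finrank_plane]; push_cast; linarith) (Eventually.of_forall fun x => ?_) ?_
    · rw [Real.norm_eq_abs, abs_of_nonneg (by positivity), one_mul]
    · exact (measurable_norm.pow_const _).aestronglyMeasurable
  refine ⟨∫ x in cell, ‖x‖ ^ (-(3 * γ)), integral_nonneg fun x => by positivity, fun μ hμ =>
    energyIntegral_le_norm hγ0 hμ (by norm_num) hint fun x _ hx0 => ?_⟩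
  have hx : 0 < ‖x‖ := norm_pos_iff.2 hx0
  have h1 : (‖x‖ ^ (2 * γ)) ^ (-(3 / 2) : ℝ) = ‖x‖ ^ (-(3 * γ)) := by
    rw [← Real.rpow_mul hx.le]; congr 1; ring
  rw [← h1]
  exact Real.rpow_le_rpow_of_nonpos (by positivity) (by linarith) (by norm_num)

/-- Polar coordinates for the sup norm, whose unit ball has area `4`, reduce this to `8 ∫ r / (m +
r²)` over `[0, 1/2]`. -/
theorem integral_cell_inv_add_sq {m : ℝ} (hm : 0 < m) :
    ∫ x in cell, (m + ‖x‖ ^ 2)⁻¹ = 4 * Real.log ((m + 1 / 4) / m) := by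
  have h1 : ∫ x in cell, (m + ‖x‖ ^ 2)⁻¹
      = ∫ x : ℝ × ℝ, (Iic (1 / 2 : ℝ)).indicator (fun r => (m + r ^ 2)⁻¹) ‖x‖ := by
    rw [← integral_indicator measurableSet_cell]
    refine integral_congr_ae (Eventually.of_forall fun x => ?_)
    simp [indicator, cell]
  have hvol : (volume : Measure (ℝ × ℝ)).real (Metric.ball 0 1) = 4 := by
    rw [show (0 : ℝ × ℝ) = (0, 0) from rfl, ← ball_prod_same, Measure.volume_eq_prod,
      measureReal_prod_prod, Real.ball_eq_Ioo]
    simp [measureReal_def]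
    norm_num
  rw [h1, integral_fun_norm_addHaar, finrank_plane, hvol]
  have h2 : ∫ y in Ioi (0 : ℝ), y ^ (2 - 1) • (Iic (1 / 2 : ℝ)).indicator (fun r => (m + r ^ 2)⁻¹) y
      = ∫ y in (0 : ℝ)..(1 / 2), y * (m + y ^ 2)⁻¹ := by
    rw [intervalIntegral.integral_of_le (by norm_num), ← Ioi_inter_Iic,
      ← setIntegral_indicator measurableSet_Iic]
    refine integral_congr_ae (Eventually.of_forall fun y => ?_)
    simp only [indicator]
    split_ifs <;> simp
  have h3 : ∫ y in (0 : ℝ)..(1 / 2), y * (m + y ^ 2)⁻¹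
      = Real.log (m + (1 / 2) ^ 2) / 2 - Real.log (m + 0 ^ 2) / 2 := by
    refine intervalIntegral.integral_eq_sub_of_hasDerivAt
      (f := fun y => Real.log (m + y ^ 2) / 2) (fun y _ => ?_) ?_
    · have hy : m + y ^ 2 ≠ 0 := by positivity
      have := (((hasDerivAt_pow 2 y).const_add m).log hy).div_const 2
      refine this.congr_deriv ?_
      push_cast
      field_simp
    · apply Continuous.intervalIntegrable
      exact continuous_id.mul ((by fun_prop : Continuous fun y : ℝ => m + y ^ 2).inv₀
        fun y => by positivity)
  rw [h2, h3, Real.log_div (by positivity) hm.ne']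
  norm_num
  ring

/-- Upper bound for `∫ (μ + U)^(-3/2)` in the borderline case. -/
theorem energyIntegral_le_of_eq (hγ : γ = 2 / 3) (hμ : 0 < μ) (hμ1 : μ ≤ 1) :
    energyIntegral γ (-(3 / 2)) μ ≤ 4 * (1 + 3 / 2 * (-Real.log μ)) := by
  have hm : 0 < μ ^ (3 / 2 : ℝ) := by positivity
  have hint : IntegrableOn (fun x : ℝ × ℝ => (μ ^ (3 / 2 : ℝ) + ‖x‖ ^ 2)⁻¹) cell := by
    have h : Continuous fun x : ℝ × ℝ => (μ ^ (3 / 2 : ℝ) + ‖x‖ ^ 2)⁻¹ :=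
      (by fun_prop : Continuous fun x : ℝ × ℝ => μ ^ (3 / 2 : ℝ) + ‖x‖ ^ 2).inv₀
        fun x => by positivity
    exact h.continuousOn.integrableOn_compact isCompact_cell
  have h1 := energyIntegral_le_norm (γ := γ) (a := -(3 / 2)) (by rw [hγ]; norm_num) hμ (by norm_num) hint
    fun x _ _ => by
      -- Superadditivity of `t^(3/2)` separates `μ` from `‖x‖^(2γ)`, and `γ = 2/3` makes the second
      -- term exactly `‖x‖²`.
      have h2 := Real.add_rpow_le_rpow_add (p := 3 / 2) hμ.le
        (Real.rpow_nonneg (norm_nonneg x) (2 * γ)) (by norm_num)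
      have h3 : (‖x‖ ^ (2 * γ)) ^ (3 / 2 : ℝ) = ‖x‖ ^ 2 := by
        rw [← Real.rpow_mul (norm_nonneg x), hγ, ← Real.rpow_natCast]
        norm_num
      rw [h3] at h2
      rw [Real.rpow_neg (by positivity)]
      exact inv_anti₀ (by positivity) h2
  rw [integral_cell_inv_add_sq hm, Real.log_div (by positivity) hm.ne', Real.log_rpow hμ] at h1
  have h4 : Real.log (μ ^ (3 / 2 : ℝ) + 1 / 4) ≤ 1 := by
    have h5 : μ ^ (3 / 2 : ℝ) ≤ 1 := Real.rpow_le_one hμ.le hμ1 (by norm_num)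
    have h6 := Real.log_le_sub_one_of_pos (x := μ ^ (3 / 2 : ℝ) + 1 / 4) (by positivity)
    linarith
  linarith

/-- Lower bound for `∫ (μ + U)^(-1/2)`. -/
theorem le_energyIntegral_half (hγ : 0 < γ) {M : ℝ} (hM : 0 < M) :
    ∃ c, 0 < c ∧ ∀ μ, 0 < μ → μ ≤ M → c * μ ^ (1 / γ - 1 / 2) ≤ energyIntegral γ (-(1 / 2)) μ := by
  -- This `b` keeps the ball of radius `r = b μ^(1/(2γ))` inside `cell` for all `μ ≤ M`. On that
  -- ball `μ + U ≤ Kμ`, and its area is `4r²`.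
  set b : ℝ := (2 * M ^ (1 / (2 * γ)))⁻¹ with hb
  have hb0 : 0 < b := by positivity
  set K : ℝ := 1 + (40 * b ^ 2) ^ γ with hK
  have hK0 : 0 < K := by positivity
  refine ⟨4 * b ^ 2 * K ^ (-(1 / 2) : ℝ), by positivity, fun μ hμ hμM => ?_⟩
  set r : ℝ := b * μ ^ (1 / (2 * γ)) with hr
  have hr0 : 0 < r := by positivity
  have hr1 : r ≤ 1 / 2 := by
    have h1 : μ ^ (1 / (2 * γ)) ≤ M ^ (1 / (2 * γ)) :=
      Real.rpow_le_rpow hμ.le hμM (by positivity)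
    calc r ≤ b * M ^ (1 / (2 * γ)) := by rw [hr]; gcongr
      _ = 1 / 2 := by rw [hb]; field_simp
  have hr2 : (40 * r ^ 2) ^ γ = (40 * b ^ 2) ^ γ * μ := by
    have h1 : 40 * r ^ 2 = (40 * b ^ 2) * μ ^ (1 / γ) := by
      have : (μ ^ (1 / (2 * γ))) ^ 2 = μ ^ (1 / γ) := by
        rw [← Real.rpow_natCast, ← Real.rpow_mul hμ.le]
        congr 1
        push_cast
        field_simp
      rw [hr, mul_pow, this]
      ring
    rw [h1, Real.mul_rpow (by positivity) (by positivity), ← Real.rpow_mul hμ.le,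
      one_div_mul_cancel hγ.ne', Real.rpow_one]
  have hvol : (volume : Measure (ℝ × ℝ)).real (Metric.closedBall 0 r) = 4 * r ^ 2 := by
    rw [show (0 : ℝ × ℝ) = (0, 0) from rfl, ← closedBall_prod_same, Measure.volume_eq_prod,
      measureReal_prod_prod, Real.closedBall_eq_Icc, measureReal_def, Real.volume_Icc,
      ENNReal.toReal_ofReal (by linarith)]
    ring
  have hint := integrableOn_energy_rpow hγ hμ (-(1 / 2))
  have hsub : Metric.closedBall (0 : ℝ × ℝ) r ⊆ cell := Metric.closedBall_subset_closedBall hr1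
  have hpos : ∀ x, 0 ≤ (μ + cosSum x ^ γ) ^ (-(1 / 2) : ℝ) := fun x =>
    Real.rpow_nonneg (by linarith [cosSum_rpow_nonneg (γ := γ) x]) _
  calc 4 * b ^ 2 * K ^ (-(1 / 2) : ℝ) * μ ^ (1 / γ - 1 / 2)
      = 4 * r ^ 2 * (K * μ) ^ (-(1 / 2) : ℝ) := by
        have h1 : r ^ 2 = b ^ 2 * μ ^ (1 / γ) := by
          rw [hr, mul_pow, ← Real.rpow_natCast (μ ^ (1 / (2 * γ))), ← Real.rpow_mul hμ.le]
          congr 2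
          push_cast
          field_simp
        rw [h1, Real.mul_rpow hK0.le hμ.le, sub_eq_add_neg, Real.rpow_add hμ]
        ring
    _ = ∫ x in Metric.closedBall (0 : ℝ × ℝ) r, (K * μ) ^ (-(1 / 2) : ℝ) := by
        rw [setIntegral_const, hvol, smul_eq_mul]
    _ ≤ ∫ x in Metric.closedBall (0 : ℝ × ℝ) r, (μ + cosSum x ^ γ) ^ (-(1 / 2) : ℝ) := by
        refine setIntegral_mono_on (integrableOn_const (by
          exact (isCompact_closedBall _ _).measure_lt_top.ne)) (hint.mono_set hsub)
          measurableSet_closedBall fun x hx => ?_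
        refine Real.rpow_le_rpow_of_nonpos (by linarith [cosSum_rpow_nonneg (γ := γ) x]) ?_
          (by norm_num)
        have hx' : ‖x‖ ≤ r := by simpa using hx
        have h1 : cosSum x ≤ 40 * r ^ 2 := (cosSum_le_norm_sq x).trans (by gcongr)
        have h2 := Real.rpow_le_rpow (cosSum_nonneg x) h1 hγ.le
        rw [hr2] at h2
        rw [hK]
        linarith
    _ ≤ energyIntegral γ (-(1 / 2)) μ :=
        setIntegral_mono_set hint (Eventually.of_forall hpos) hsub.eventuallyLE

end

/-! ### Momentum, velocity and acceleration as functions of the energy. -/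

section

theorem monotoneOn_sub_of_hasDerivAt_le {D : Set ℝ} (hD : Convex ℝ D) {f g f' g' : ℝ → ℝ}
    (hf : ContinuousOn f D) (hg : ContinuousOn g D) (hf' : ∀ x ∈ interior D, HasDerivAt f (f' x) x)
    (hg' : ∀ x ∈ interior D, HasDerivAt g (g' x) x) (h : ∀ x ∈ interior D, f' x ≤ g' x) :
    MonotoneOn (fun x => g x - f x) D := by
  refine monotoneOn_of_hasDerivWithinAt_nonneg (f' := fun x => g' x - f' x) hD (hg.sub hf)
    (fun x hx => ((hg' x hx).fun_sub (hf' x hx)).hasDerivWithinAt) fun x hx => ?_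
  linarith [h x hx]

/-- Together with `monotoneOn_sub_of_hasDerivAt_le` this turns `f' ≤ g'` into a bound on increments
without integrating derivatives that may blow up at an endpoint. -/
theorem abs_sub_le_of_monotoneOn {D : Set ℝ} {f g : ℝ → ℝ} (hf : MonotoneOn f D)
    (hg : MonotoneOn (fun x => g x - f x) D) {x y : ℝ} (hx : x ∈ D) (hy : y ∈ D) :
    |f y - f x| ≤ |g y - g x| := by
  rcases le_total x y with h | h
  · have h1 := hf hx hy h
    have h2 := hg hx hy h
    simp only at h2
    rw [abs_of_nonneg (by linarith), abs_of_nonneg (by linarith)]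
    linarith
  · have h1 := hf hy hx h
    have h2 := hg hy hx h
    simp only at h2
    rw [abs_of_nonpos (by linarith), abs_of_nonpos (by linarith)]
    linarith

theorem abs_rpow_sub_rpow_le {x y β : ℝ} (hx : 0 ≤ x) (hy : 0 ≤ y) (hβ : 0 ≤ β) (hβ1 : β ≤ 1) :
    |y ^ β - x ^ β| ≤ |y - x| ^ β := by
  wlog h : x ≤ y generalizing x y
  · rw [abs_sub_comm, abs_sub_comm y x]
    exact this hy hx (le_of_not_ge h)
  rw [abs_of_nonneg (sub_nonneg.2 (Real.rpow_le_rpow hx h hβ)), abs_of_nonneg (sub_nonneg.2 h)]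
  have := Real.rpow_add_le_add_rpow hx (sub_nonneg.2 h) hβ hβ1
  rw [add_sub_cancel] at this
  linarith

variable {γ μ : ℝ}

theorem momentum_eq_energyIntegral (γ μ : ℝ) :
    momentum γ μ = √2 * energyIntegral γ (1 / 2) μ := by
  rw [momentum, energyIntegral, cosMean, cosMean, ← integral_const_mul]
  refine integral_congr_ae (Eventually.of_forall fun x => ?_)
  simp only [speed]
  rw [Real.sqrt_mul (by norm_num), ← Real.sqrt_eq_rpow]

theorem hasDerivAt_momentum (hγ : 0 < γ) (hμ : 0 < μ) :
    HasDerivAt (momentum γ) (√2 / 2 * energyIntegral γ (-(1 / 2)) μ) μ := by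
  have h := (hasDerivAt_energyIntegral hγ hμ (1 / 2)).const_mul √2
  have h2 : HasDerivAt (momentum γ) (√2 * (1 / 2 * energyIntegral γ (1 / 2 - 1) μ)) μ := by
    exact h.congr_of_eventuallyEq (Eventually.of_forall (momentum_eq_energyIntegral γ))
  refine h2.congr_deriv ?_
  norm_num
  ring

theorem continuous_momentum (hγ : 0 < γ) : Continuous (momentum γ) := by
  refine continuous_parametric_integral_of_continuous (f := fun μ x => speed γ μ (cosSum x)) ?_
    isCompact_cell
  have h : Continuous fun p : ℝ × ℝ × ℝ => p.1 + cosSum p.2 ^ γ :=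
    continuous_fst.add ((continuous_cosSum_rpow hγ).comp continuous_snd)
  exact (continuous_const.mul h).sqrt

theorem energyIntegral_half_pos (hγ : 0 < γ) (hμ : 0 < μ) : 0 < energyIntegral γ (-(1 / 2)) μ :=
  lt_of_lt_of_le (by positivity) (le_energyIntegral hγ hμ (by norm_num))

theorem sqrt_le_momentum (hγ : 0 < γ) : √(2 * μ) ≤ momentum γ μ := by
  have h : ∫ _ in cell, √(2 * μ) = √(2 * μ) := by simp
  have hc : Continuous fun x => speed γ μ (cosSum x) := (continuous_speed hγ).comp continuous_cosSum
  rw [← h, momentum, cosMean]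
  refine integral_mono (integrable_const _) (hc.continuousOn.integrableOn_compact isCompact_cell)
    fun x => Real.sqrt_le_sqrt ?_
  linarith [cosSum_rpow_nonneg (γ := γ) x]

theorem le_momentum_sq (hγ : 0 < γ) (hμ : 0 ≤ μ) : μ ≤ momentum γ μ ^ 2 / 2 := by
  have h := pow_le_pow_left₀ (Real.sqrt_nonneg _) (sqrt_le_momentum (μ := μ) hγ) 2
  rw [Real.sq_sqrt (by positivity)] at h
  linarith

theorem exists_momentum_eq (hγ : 0 < γ) {p : ℝ} (hp : momentum γ 0 ≤ p) :
    ∃ μ, 0 ≤ μ ∧ momentum γ μ = p := by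
  have hp0 : 0 ≤ p := (momentum_pos hγ le_rfl).le.trans hp
  have h1 : p ≤ momentum γ (p ^ 2 / 2) := by
    have := sqrt_le_momentum (μ := p ^ 2 / 2) hγ
    rwa [mul_div_cancel₀ _ two_ne_zero, Real.sqrt_sq hp0] at this
  obtain ⟨μ, hμ, h⟩ := intermediate_value_Icc (show (0 : ℝ) ≤ p ^ 2 / 2 by positivity)
    (continuous_momentum hγ).continuousOn ⟨hp, h1⟩
  exact ⟨μ, hμ.1, h⟩

/-- The derivative of the momentum is bounded below on `(0, M]`, even though it may blow up at `0`.
This makes the inverse map Lipschitz up to `p₀`. -/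
theorem sub_le_momentum_sub (hγ : 0 < γ) (M : ℝ) (hM : 0 ≤ M) :
    ∃ c, 0 < c ∧ ∀ μ ν, 0 ≤ μ → μ ≤ ν → ν ≤ M → c * (ν - μ) ≤ momentum γ ν - momentum γ μ := by
  refine ⟨√2 / 2 * (M + 4 ^ γ) ^ (-(1 / 2) : ℝ), by positivity, fun μ ν h0 h1 h2 => ?_⟩
  have hint : ∀ x ∈ interior (Icc 0 M), HasDerivAt (momentum γ)
      (√2 / 2 * energyIntegral γ (-(1 / 2)) x) x := fun x hx => by
    rw [interior_Icc] at hx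
    exact hasDerivAt_momentum hγ hx.1
  refine (convex_Icc 0 M).mul_sub_le_image_sub_of_le_deriv (continuous_momentum hγ).continuousOn
    (fun x hx => (hint x hx).differentiableAt.differentiableWithinAt) (fun x hx => ?_)
    μ ⟨h0, h1.trans h2⟩ ν ⟨h0.trans h1, h2⟩ h1
  rw [(hint x hx).deriv]
  rw [interior_Icc] at hx
  refine mul_le_mul_of_nonneg_left (le_trans ?_ (le_energyIntegral hγ hx.1 (by norm_num)))
    (by positivity)
  exact Real.rpow_le_rpow_of_nonpos (add_pos hx.1 (by positivity)) (by linarith [hx.2])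
    (by norm_num)

/-- The reciprocal of the derivative of the momentum. -/
noncomputable def velocityAux (γ μ : ℝ) : ℝ := √2 / energyIntegral γ (-(1 / 2)) μ

/-- The derivative of `velocityAux`. -/
noncomputable def acceleration (γ μ : ℝ) : ℝ :=
  √2 / 2 * energyIntegral γ (-(3 / 2)) μ / energyIntegral γ (-(1 / 2)) μ ^ 2

/-- The effective velocity as a function of the energy, extended to energy `0` by its limit. -/
noncomputable def velocity (γ : ℝ) : ℝ → ℝ :=
  Function.update (velocityAux γ) 0 (sInf (velocityAux γ '' Ioi 0))

theorem hasDerivAt_velocityAux (hγ : 0 < γ) (hμ : 0 < μ) :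
    HasDerivAt (velocityAux γ) (acceleration γ μ) μ := by
  have hE := energyIntegral_half_pos hγ hμ
  have h := (hasDerivAt_const μ √2).fun_div (hasDerivAt_energyIntegral hγ hμ (-(1 / 2))) hE.ne'
  refine h.congr_deriv ?_
  rw [acceleration, show (-(1 / 2) - 1 : ℝ) = -(3 / 2) by norm_num]
  ring

theorem acceleration_nonneg (hμ : 0 < μ) : 0 ≤ acceleration γ μ := by
  have := energyIntegral_nonneg (γ := γ) (a := -(3 / 2)) hμ
  unfold acceleration
  positivity

theorem velocityAux_nonneg (hμ : 0 < μ) : 0 ≤ velocityAux γ μ := by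
  have := energyIntegral_nonneg (γ := γ) (a := -(1 / 2)) hμ
  unfold velocityAux
  positivity

theorem monotoneOn_velocityAux (hγ : 0 < γ) : MonotoneOn (velocityAux γ) (Ioi 0) := by
  refine monotoneOn_of_hasDerivWithinAt_nonneg (f' := acceleration γ) (convex_Ioi 0)
    (fun x hx => (hasDerivAt_velocityAux hγ hx).continuousAt.continuousWithinAt) ?_ ?_
  · intro x hx
    rw [interior_Ioi] at hx
    exact (hasDerivAt_velocityAux hγ hx).hasDerivWithinAt
  · intro x hx
    rw [interior_Ioi] at hx
    exact acceleration_nonneg hx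

theorem velocity_of_pos (hμ : 0 < μ) : velocity γ μ = velocityAux γ μ :=
  Function.update_of_ne hμ.ne' _ _

/-- A monotone function bounded below has its infimum as right limit at `0`. -/
theorem tendsto_velocityAux (hγ : 0 < γ) :
    Tendsto (velocityAux γ) (𝓝[>] 0) (𝓝 (velocity γ 0)) := by
  rw [velocity, Function.update_self]
  refine (monotoneOn_velocityAux hγ).tendsto_nhdsGT ⟨0, ?_⟩
  rintro _ ⟨x, hx, rfl⟩
  exact velocityAux_nonneg hx

theorem hasDerivAt_velocity (hγ : 0 < γ) (hμ : 0 < μ) :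
    HasDerivAt (velocity γ) (acceleration γ μ) μ := by
  refine (hasDerivAt_velocityAux hγ hμ).congr_of_eventuallyEq ?_
  filter_upwards [Ioi_mem_nhds hμ] with m hm
  exact velocity_of_pos hm

theorem continuousOn_velocity (hγ : 0 < γ) : ContinuousOn (velocity γ) (Ici 0) := by
  intro x hx
  rcases (show (0 : ℝ) ≤ x from hx).eq_or_lt with rfl | h
  · rw [← continuousWithinAt_Ioi_iff_Ici]
    refine (tendsto_velocityAux hγ).congr' ?_
    filter_upwards [self_mem_nhdsWithin] with m hm
    exact (velocity_of_pos hm).symm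
  · exact (hasDerivAt_velocity hγ h).continuousAt.continuousWithinAt

theorem monotoneOn_velocity (hγ : 0 < γ) : MonotoneOn (velocity γ) (Ici 0) := by
  refine monotoneOn_of_hasDerivWithinAt_nonneg (f' := acceleration γ) (convex_Ici 0)
    (continuousOn_velocity hγ) ?_ ?_
  · intro x hx
    rw [interior_Ici] at hx
    exact (hasDerivAt_velocity hγ hx).hasDerivWithinAt
  · intro x hx
    rw [interior_Ici] at hx
    exact acceleration_nonneg hx

theorem velocity_nonneg (hγ : 0 < γ) (hμ : 0 ≤ μ) : 0 ≤ velocity γ μ := by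
  have h0 : 0 ≤ velocity γ 0 := by
    refine ge_of_tendsto (tendsto_velocityAux hγ) ?_
    filter_upwards [self_mem_nhdsWithin] with m hm
    exact velocityAux_nonneg hm
  exact h0.trans (monotoneOn_velocity hγ (mem_Ici.2 le_rfl) hμ hμ)

/-- Replacing `U` by its upper bound `4^γ` bounds `E(-1/2)²` below by `(μ + 4^γ)⁻¹`. This crude
bound serves all cases except `γ > 2`. -/
theorem acceleration_le (hγ : 0 < γ) (hμ : 0 < μ) :
    acceleration γ μ ≤ √2 / 2 * energyIntegral γ (-(3 / 2)) μ * (μ + 4 ^ γ) := by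
  have h1 := le_energyIntegral (a := -(1 / 2)) hγ hμ (by norm_num)
  have hK : 0 < μ + 4 ^ γ := by positivity
  have h2 : (μ + 4 ^ γ)⁻¹ ≤ energyIntegral γ (-(1 / 2)) μ ^ 2 := by
    have := pow_le_pow_left₀ (by positivity) h1 2
    rw [← Real.rpow_natCast, ← Real.rpow_mul hK.le] at this
    norm_num [Real.rpow_neg_one] at this
    convert this using 2
  have h3 := energyIntegral_nonneg (γ := γ) (a := -(3 / 2)) hμ
  rw [acceleration, div_eq_mul_inv]
  refine mul_le_mul_of_nonneg_left ?_ (by positivity)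
  rw [← inv_inv (μ + 4 ^ γ)]
  exact inv_anti₀ (by positivity) h2

theorem velocity_le (hγ : 0 < γ) (hμ : 0 < μ) : velocity γ μ ≤ √2 * (μ + 4 ^ γ) ^ (1 / 2 : ℝ) := by
  have h1 := le_energyIntegral (a := -(1 / 2)) hγ hμ (by norm_num)
  have hK : 0 < μ + 4 ^ γ := by positivity
  rw [velocity_of_pos hμ, velocityAux, div_eq_mul_inv]
  refine mul_le_mul_of_nonneg_left ?_ (by positivity)
  rw [Real.rpow_neg hK.le] at h1
  have := inv_anti₀ (by positivity) h1
  rwa [inv_inv] at this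

/-- By the chain rule the product is the second derivative of `Hbar` in `p`. The bound is uniform up
to infinite energy. -/
theorem acceleration_mul_velocity_le (hγ : 0 < γ) {m : ℝ} (hm : 0 < m) (hμ : m ≤ μ) :
    acceleration γ μ * velocity γ μ ≤ (1 + 4 ^ γ / m) ^ (3 / 2 : ℝ) := by
  have hμ0 : 0 < μ := hm.trans_le hμ
  have hK : 0 < μ + 4 ^ γ := by positivity
  have h1 := acceleration_le hγ hμ0
  have h2 := energyIntegral_le (a := -(3 / 2)) hγ hμ0 (by norm_num)
  have h3 : acceleration γ μ ≤ √2 / 2 * μ ^ (-(3 / 2) : ℝ) * (μ + 4 ^ γ) := h1.trans (by gcongr)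
  calc acceleration γ μ * velocity γ μ
      ≤ (√2 / 2 * μ ^ (-(3 / 2) : ℝ) * (μ + 4 ^ γ)) * (√2 * (μ + 4 ^ γ) ^ (1 / 2 : ℝ)) :=
        mul_le_mul h3 (velocity_le hγ hμ0) (velocity_nonneg hγ hμ0.le) (by positivity)
    _ = μ ^ (-(3 / 2) : ℝ) * ((μ + 4 ^ γ) * (μ + 4 ^ γ) ^ (1 / 2 : ℝ)) := by
        have : √2 * √2 = 2 := Real.mul_self_sqrt (by norm_num)
        linear_combination (1 / 2) * μ ^ (-(3 / 2) : ℝ) * (μ + 4 ^ γ) *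
          (μ + 4 ^ γ) ^ (1 / 2 : ℝ) * this
    _ = ((μ + 4 ^ γ) / μ) ^ (3 / 2 : ℝ) := by
        rw [← Real.rpow_one_add' hK.le (by norm_num), Real.div_rpow hK.le hμ0.le,
          Real.rpow_neg hμ0.le]
        norm_num
        ring
    _ ≤ _ := by
        refine Real.rpow_le_rpow (by positivity) ?_ (by norm_num)
        rw [add_div, div_self hμ0.ne']
        gcongr

/-- Acceleration bound when the velocity vanishes at zero energy. -/
theorem acceleration_le_of_two_lt (hγ : 2 < γ) (M : ℝ) (hM : 0 < M) :
    ∃ C, 0 ≤ C ∧ ∀ μ, 0 < μ → μ ≤ M → acceleration γ μ ≤ C * μ ^ (1 / 2 - 1 / γ - 1) := by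
  obtain ⟨C, hC, h1⟩ := energyIntegral_le_of_gt (γ := γ) (by linarith)
  obtain ⟨c, hc, h2⟩ := le_energyIntegral_half (γ := γ) (by linarith) hM
  refine ⟨√2 / 2 * C / c ^ 2, by positivity, fun μ hμ hμM => ?_⟩
  have h3 := h1 μ hμ
  have h4 := pow_le_pow_left₀ (by positivity) (h2 μ hμ hμM) 2
  have h5 := energyIntegral_nonneg (γ := γ) (a := -(3 / 2)) hμ
  -- The blow-up of the denominator is essential: `μ^(1/γ - 3/2)` alone is not integrable at `0`
  -- when `γ > 2`, whereas subtracting `2(1/γ - 1/2)` leaves the exponent `-1/2 - 1/γ > -1`.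
  calc acceleration γ μ ≤ √2 / 2 * (C * μ ^ (1 / γ - 3 / 2)) / (c * μ ^ (1 / γ - 1 / 2)) ^ 2 := by
        unfold acceleration
        gcongr
    _ = √2 / 2 * C / c ^ 2 * (μ ^ (1 / γ - 3 / 2) / (μ ^ (1 / γ - 1 / 2)) ^ 2) := by
        field_simp
    _ = _ := by
        rw [← Real.rpow_natCast (μ ^ _), ← Real.rpow_mul hμ.le, ← Real.rpow_sub hμ]
        congr 2
        push_cast
        ring

/-- The exponent is `β - 1` with `β = 1/γ - 1/2`: it integrates to `μ^β` for `γ < 2` and to `log μ`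
at `γ = 2`. -/
theorem acceleration_le_of_two_thirds_lt (hγ : 2 / 3 < γ) (M : ℝ) (hM : 0 < M) :
    ∃ C, 0 ≤ C ∧ ∀ μ, 0 < μ → μ ≤ M → acceleration γ μ ≤ C * μ ^ (1 / γ - 1 / 2 - 1) := by
  obtain ⟨C, hC, h1⟩ := energyIntegral_le_of_gt hγ
  refine ⟨√2 / 2 * C * (M + 4 ^ γ), by positivity, fun μ hμ hμM => ?_⟩
  refine (acceleration_le (by linarith) hμ).trans ?_
  calc √2 / 2 * energyIntegral γ (-(3 / 2)) μ * (μ + 4 ^ γ)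
      ≤ √2 / 2 * (C * μ ^ (1 / γ - 3 / 2)) * (M + 4 ^ γ) := by
        have := h1 μ hμ
        gcongr
    _ = _ := by
        rw [show 1 / γ - 1 / 2 - 1 = 1 / γ - 3 / 2 by ring]
        ring

theorem acceleration_le_of_eq (hγ : γ = 2 / 3) :
    ∃ C, 0 ≤ C ∧ (∀ μ, 0 < μ → μ ≤ 1 → acceleration γ μ ≤ C * (1 - Real.log μ)) ∧
      ∀ μ, 1 ≤ μ → acceleration γ μ ≤ C := by
  have hγ0 : 0 < γ := by rw [hγ]; norm_num
  have h2 : √2 / 2 ≤ 1 := by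
    have : √2 ≤ 2 := Real.sqrt_le_iff.2 (by norm_num)
    linarith
  refine ⟨6 * (1 + 4 ^ γ), by positivity, fun μ hμ hμ1 => ?_, fun μ hμ => ?_⟩
  · have h1 := energyIntegral_le_of_eq hγ hμ hμ1
    have hlog := Real.log_nonpos hμ.le hμ1
    calc acceleration γ μ ≤ √2 / 2 * energyIntegral γ (-(3 / 2)) μ * (μ + 4 ^ γ) :=
          acceleration_le hγ0 hμ
      _ ≤ 1 * (6 * (1 - Real.log μ)) * (1 + 4 ^ γ) := by
          have h3 : energyIntegral γ (-(3 / 2)) μ ≤ 6 * (1 - Real.log μ) := by linarith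
          have h4 := energyIntegral_nonneg (γ := γ) (a := -(3 / 2)) hμ
          have h5 : 0 ≤ 1 - Real.log μ := by linarith
          gcongr
      _ = _ := by ring
  · have hμ0 : 0 < μ := by linarith
    have h1 := energyIntegral_le (a := -(3 / 2)) hγ0 hμ0 (by norm_num)
    -- One power of `μ⁻¹` is enough to absorb the growing factor `μ + 4^γ`.
    have h3 : μ ^ (-(3 / 2) : ℝ) ≤ μ⁻¹ := by
      rw [← Real.rpow_neg_one]
      exact Real.rpow_le_rpow_of_exponent_le hμ (by norm_num)
    have h4 := energyIntegral_nonneg (γ := γ) (a := -(3 / 2)) hμ0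
    calc acceleration γ μ ≤ √2 / 2 * energyIntegral γ (-(3 / 2)) μ * (μ + 4 ^ γ) :=
          acceleration_le hγ0 hμ0
      _ ≤ 1 * μ⁻¹ * (μ + 4 ^ γ) := by
          have := h1.trans h3
          gcongr
      _ = 1 + 4 ^ γ * μ⁻¹ := by field_simp
      _ ≤ 1 + 4 ^ γ * 1 := by
          have := inv_le_one_of_one_le₀ hμ
          gcongr
      _ ≤ _ := by
          have : (0 : ℝ) < 4 ^ γ := by positivity
          linarith

theorem acceleration_mul_velocity_le_of_lt (hγ0 : 0 < γ) (hγ : γ < 2 / 3) :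
    ∃ C, 0 ≤ C ∧ ∀ μ, 0 < μ → acceleration γ μ * velocity γ μ ≤ C := by
  obtain ⟨C, hC, h⟩ := energyIntegral_le_of_lt hγ0 hγ
  refine ⟨max (√2 / 2 * C * (1 + 4 ^ γ) * velocity γ 1) ((1 + 4 ^ γ / 1) ^ (3 / 2 : ℝ)),
    le_max_of_le_right (by positivity), fun μ hμ => ?_⟩
  rcases le_total 1 μ with h1 | h1
  · exact le_max_of_le_right (acceleration_mul_velocity_le hγ0 one_pos h1)
  · refine le_max_of_le_left ?_
    have h2 := h μ hμ
    have h4 := energyIntegral_nonneg (γ := γ) (a := -(3 / 2)) hμ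
    have h3 : acceleration γ μ ≤ √2 / 2 * C * (1 + 4 ^ γ) :=
      (acceleration_le hγ0 hμ).trans (by gcongr)
    exact mul_le_mul h3 (monotoneOn_velocity hγ0 hμ.le (mem_Ici.2 zero_le_one) h1)
      (velocity_nonneg hγ0 hμ.le) (by positivity)

/-- For `γ > 2` the lower bound `c μ^(1/γ - 1/2)` for `E(-1/2)` tends to infinity, so its reciprocal
tends to `0`. This removes the corner of `Hbar` at `±p₀`. -/
theorem velocity_zero_of_two_lt (hγ : 2 < γ) : velocity γ 0 = 0 := by
  have hγ0 : 0 < γ := by linarith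
  obtain ⟨c, hc, h⟩ := le_energyIntegral_half hγ0 one_pos
  have hβ : 0 < 1 / 2 - 1 / γ := by
    have : 1 / γ < 1 / 2 := one_div_lt_one_div_of_lt (by norm_num) hγ
    linarith
  refine tendsto_nhds_unique (tendsto_velocityAux hγ0) ?_
  have hlim : Tendsto (fun μ : ℝ => √2 / c * μ ^ (1 / 2 - 1 / γ)) (𝓝[>] 0) (𝓝 0) := by
    have h1 : Continuous fun μ : ℝ => √2 / c * μ ^ (1 / 2 - 1 / γ) :=
      continuous_const.mul (Real.continuous_rpow_const hβ.le)
    have h2 := h1.tendsto 0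
    rw [Real.zero_rpow hβ.ne', mul_zero] at h2
    exact h2.mono_left nhdsWithin_le_nhds
  refine tendsto_of_tendsto_of_tendsto_of_le_of_le' tendsto_const_nhds hlim ?_ ?_
  · filter_upwards [self_mem_nhdsWithin] with m hm using velocityAux_nonneg hm
  · filter_upwards [Ioc_mem_nhdsGT one_pos] with m hm
    have hm0 : 0 < m := hm.1
    calc velocityAux γ m ≤ √2 / (c * m ^ (1 / γ - 1 / 2)) := by
          have := h m hm.1 hm.2
          unfold velocityAux
          gcongr
      _ = _ := by
          rw [show 1 / γ - 1 / 2 = -(1 / 2 - 1 / γ) by ring, Real.rpow_neg hm0.le]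
          field_simp

end

/-! ### The effective Hamiltonian as the inverse of the momentum. -/

section

/-- `Hbar` vanishes on `[-p₀, p₀]` and is the inverse of the momentum map of `|p|` elsewhere. -/
structure IsInverseMomentum (γ : ℝ) (Hbar : ℝ → ℝ) : Prop where
  eq_zero : ∀ p, |p| ≤ momentum γ 0 → Hbar p = 0
  eq_energy : ∀ μ p, 0 ≤ μ → |p| = momentum γ μ → Hbar p = μ

variable {γ : ℝ} {Hbar : ℝ → ℝ} {p q : ℝ}

theorem isInverseMomentum_effectiveHamiltonian {ξ : ℝ × ℝ} (hγ : 0 < γ) (hξ : NonResonant ξ)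
    (θ : ℝ) : IsInverseMomentum γ (effectiveHamiltonian (lineHamiltonian γ ξ θ)) :=
  ⟨fun _ => effectiveHamiltonian_eq_zero hγ hξ, fun _ _ h₁ h₂ =>
    effectiveHamiltonian_eq_energy hγ hξ h₁ h₂⟩

theorem momentum_mono (hγ : 0 < γ) {μ ν : ℝ} (hμ : 0 ≤ μ) (h : μ ≤ ν) :
    momentum γ μ ≤ momentum γ ν := by
  obtain ⟨c, hc, hle⟩ := sub_le_momentum_sub hγ ν (hμ.trans h)
  have := hle μ ν hμ h le_rfl
  nlinarith

namespace IsInverseMomentum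

theorem spec (h : IsInverseMomentum γ Hbar) (hγ : 0 < γ) (hp : momentum γ 0 ≤ p) :
    0 ≤ Hbar p ∧ momentum γ (Hbar p) = p := by
  obtain ⟨μ, hμ, rfl⟩ := exists_momentum_eq hγ hp
  rw [h.eq_energy μ _ hμ (abs_of_pos (momentum_pos hγ hμ))]
  exact ⟨hμ, rfl⟩

theorem pos (h : IsInverseMomentum γ Hbar) (hγ : 0 < γ) (hp : momentum γ 0 < p) : 0 < Hbar p := by
  obtain ⟨h1, h2⟩ := h.spec hγ hp.le
  refine h1.lt_of_ne fun h3 => hp.ne ?_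
  rw [h3, h2]

theorem even (h : IsInverseMomentum γ Hbar) (hγ : 0 < γ) (p : ℝ) : Hbar (-p) = Hbar p := by
  rcases le_total |p| (momentum γ 0) with h1 | h1
  · rw [h.eq_zero p h1, h.eq_zero (-p) (by rwa [abs_neg])]
  · obtain ⟨μ, hμ, h2⟩ := exists_momentum_eq hγ h1
    rw [h.eq_energy μ p hμ h2.symm, h.eq_energy μ (-p) hμ (by rw [abs_neg, h2])]

theorem le_sq (h : IsInverseMomentum γ Hbar) (hγ : 0 < γ) (hp : momentum γ 0 ≤ p) :
    Hbar p ≤ p ^ 2 / 2 := by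
  obtain ⟨h1, h2⟩ := h.spec hγ hp
  have := le_momentum_sq hγ h1
  rwa [h2] at this

theorem le_sq_of_le (h : IsInverseMomentum γ Hbar) (hγ : 0 < γ) {P : ℝ} (hp : momentum γ 0 ≤ p)
    (hP : p ≤ P) : Hbar p ≤ P ^ 2 / 2 := by
  have h1 := h.le_sq hγ hp
  have h2 := pow_le_pow_left₀ ((momentum_pos hγ le_rfl).le.trans hp) hP 2
  linarith

theorem mono (h : IsInverseMomentum γ Hbar) (hγ : 0 < γ) (hp : momentum γ 0 ≤ p) (hpq : p ≤ q) :
    Hbar p ≤ Hbar q := by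
  obtain ⟨-, h2⟩ := h.spec hγ hp
  obtain ⟨h3, h4⟩ := h.spec hγ (hp.trans hpq)
  by_contra! hlt
  have h5 := momentum_mono hγ h3 hlt.le
  rw [h2, h4] at h5
  rw [le_antisymm hpq h5] at hlt
  exact lt_irrefl _ hlt

theorem exists_lipschitz (h : IsInverseMomentum γ Hbar) (hγ : 0 < γ) (P : ℝ) :
    ∃ C, 0 ≤ C ∧ ∀ p ∈ Icc (momentum γ 0) P, ∀ q ∈ Icc (momentum γ 0) P,
      |Hbar q - Hbar p| ≤ C * |q - p| := by
  obtain ⟨c, hc, hle⟩ := sub_le_momentum_sub hγ (P ^ 2 / 2) (by positivity)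
  refine ⟨c⁻¹, by positivity, fun p hp q hq => ?_⟩
  wlog hpq : p ≤ q generalizing p q
  · rw [abs_sub_comm, abs_sub_comm q]
    exact this q hq p hp (le_of_not_ge hpq)
  obtain ⟨h1, h2⟩ := h.spec hγ hp.1
  obtain ⟨h3, h4⟩ := h.spec hγ hq.1
  have h5 := h.mono hγ hp.1 hpq
  have h6 := hle _ _ h1 h5 (h.le_sq_of_le hγ hq.1 hq.2)
  rw [h2, h4] at h6
  rw [abs_of_nonneg (by linarith), abs_of_nonneg (by linarith), le_inv_mul_iff₀ hc]
  exact h6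

theorem continuousOn (h : IsInverseMomentum γ Hbar) (hγ : 0 < γ) :
    ContinuousOn Hbar (Ici (momentum γ 0)) := by
  intro p hp
  obtain ⟨C, hC, hlip⟩ := h.exists_lipschitz hγ (p + 1)
  have h1 : ContinuousOn Hbar (Icc (momentum γ 0) (p + 1)) := by
    refine LipschitzOnWith.continuousOn (K := C.toNNReal) (LipschitzOnWith.of_dist_le_mul ?_)
    intro x hx y hy
    rw [Real.dist_eq, Real.dist_eq, Real.coe_toNNReal _ hC]
    exact hlip y hy x hx
  refine (h1 p ⟨hp, by linarith⟩).mono_of_mem_nhdsWithin ?_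
  rw [← Ici_inter_Iic]
  exact inter_mem self_mem_nhdsWithin (mem_nhdsWithin_of_mem_nhds (Iic_mem_nhds (by linarith)))

theorem hasDerivAt (h : IsInverseMomentum γ Hbar) (hγ : 0 < γ) (hp : momentum γ 0 < p) :
    HasDerivAt Hbar (velocity γ (Hbar p)) p := by
  have hpos := h.pos hγ hp
  have hE := energyIntegral_half_pos hγ hpos
  have h1 := HasDerivAt.of_local_left_inverse (f := momentum γ) (g := Hbar) (a := p)
    ((h.continuousOn hγ).continuousAt (Ici_mem_nhds hp)) (hasDerivAt_momentum hγ hpos)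
    (by positivity) (by
      filter_upwards [Ioi_mem_nhds hp] with q hq
      exact (h.spec hγ (le_of_lt hq)).2)
  refine h1.congr_deriv ?_
  rw [velocity_of_pos hpos, velocityAux]
  have h2 : √2 * √2 = 2 := Real.mul_self_sqrt (by norm_num)
  have h3 : √2 ≠ 0 := by positivity
  field_simp
  linarith

theorem apply_momentum_zero (h : IsInverseMomentum γ Hbar) (hγ : 0 < γ) :
    Hbar (momentum γ 0) = 0 :=
  h.eq_energy 0 _ le_rfl (abs_of_pos (momentum_pos hγ le_rfl))

theorem continuousOn_velocity (h : IsInverseMomentum γ Hbar) (hγ : 0 < γ) :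
    ContinuousOn (fun p => velocity γ (Hbar p)) (Ici (momentum γ 0)) :=
  (EffectiveHamiltonian.continuousOn_velocity hγ).comp (h.continuousOn hγ)
    fun _ hp => (h.spec hγ hp).1

/-- At `p₀` the momentum need not have a finite derivative to invert, so the one-sided derivative is
obtained as the limit of the derivatives from the right. -/
theorem hasDerivWithinAt (h : IsInverseMomentum γ Hbar) (hγ : 0 < γ) (hp : momentum γ 0 ≤ p) :
    HasDerivWithinAt Hbar (velocity γ (Hbar p)) (Ici (momentum γ 0)) p := by
  rcases hp.eq_or_lt with rfl | hp'
  · have hc := h.continuousOn_velocity hγ (momentum γ 0) (mem_Ici.2 le_rfl)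
    refine hasDerivWithinAt_Ici_of_tendsto_deriv (s := Ioi (momentum γ 0))
      (fun q hq => (h.hasDerivAt hγ hq).differentiableAt.differentiableWithinAt)
      ((h.continuousOn hγ _ (mem_Ici.2 le_rfl)).mono Ioi_subset_Ici_self) self_mem_nhdsWithin ?_
    refine (hc.mono Ioi_subset_Ici_self).tendsto.congr' ?_
    filter_upwards [self_mem_nhdsWithin] with q hq
    exact (h.hasDerivAt hγ hq).deriv.symm
  · exact (h.hasDerivAt hγ hp').hasDerivWithinAt

theorem derivWithin_eq (h : IsInverseMomentum γ Hbar) (hγ : 0 < γ) (hp : momentum γ 0 ≤ p) :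
    derivWithin Hbar (Ici (momentum γ 0)) p = velocity γ (Hbar p) :=
  (h.hasDerivWithinAt hγ hp).derivWithin (uniqueDiffOn_Ici _ p hp)

theorem hasDerivAt_velocity (h : IsInverseMomentum γ Hbar) (hγ : 0 < γ) (hp : momentum γ 0 < p) :
    HasDerivAt (fun p => velocity γ (Hbar p))
      (acceleration γ (Hbar p) * velocity γ (Hbar p)) p :=
  (EffectiveHamiltonian.hasDerivAt_velocity hγ (h.pos hγ hp)).comp p (h.hasDerivAt hγ hp)

theorem monotoneOn_velocity (h : IsInverseMomentum γ Hbar) (hγ : 0 < γ) :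
    MonotoneOn (fun p => velocity γ (Hbar p)) (Ici (momentum γ 0)) := fun _ hp _ hq hpq =>
  EffectiveHamiltonian.monotoneOn_velocity hγ (h.spec hγ hp).1 (h.spec hγ hq).1
    (h.mono hγ hp hpq)

theorem abs_velocity_sub_le (h : IsInverseMomentum γ Hbar) (hγ : 0 < γ) {a C : ℝ} (hC : 0 ≤ C)
    (ha : momentum γ 0 ≤ a)
    (hle : ∀ p, a < p → acceleration γ (Hbar p) * velocity γ (Hbar p) ≤ C)
    (hp : a ≤ p) (hq : a ≤ q) :
    |velocity γ (Hbar q) - velocity γ (Hbar p)| ≤ C * |q - p| := by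
  have hsub : Ici a ⊆ Ici (momentum γ 0) := Ici_subset_Ici.2 ha
  have h1 := monotoneOn_sub_of_hasDerivAt_le (convex_Ici a) (f := fun p => velocity γ (Hbar p))
    (g := fun p => C * p) (f' := fun p => acceleration γ (Hbar p) * velocity γ (Hbar p))
    (g' := fun _ => C) ((h.continuousOn_velocity hγ).mono hsub) (by fun_prop)
    (fun x hx => by
      rw [interior_Ici] at hx
      exact h.hasDerivAt_velocity hγ (ha.trans_lt hx))
    (fun x _ => by simpa using (hasDerivAt_id x).const_mul C)
    (fun x hx => by rw [interior_Ici] at hx; exact hle x hx)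
  have h2 := abs_sub_le_of_monotoneOn ((h.monotoneOn_velocity hγ).mono hsub) h1 hp hq
  rwa [← mul_sub, abs_mul, abs_of_nonneg hC] at h2

/-- A power bound for the acceleration near zero energy makes the velocity uniformly locally
Hölder continuous in `p`. -/
theorem uniformlyLocallyHolderOn_velocity (h : IsInverseMomentum γ Hbar) (hγ : 0 < γ) {β : ℝ}
    (hβ : 0 < β) (hβ1 : β ≤ 1)
    (hacc : ∀ M, 0 < M → ∃ C, 0 ≤ C ∧ ∀ μ, 0 < μ → μ ≤ M →
      acceleration γ μ ≤ C * μ ^ (β - 1)) :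
    UniformlyLocallyHolderOn β (fun p => velocity γ (Hbar p)) (Ici (momentum γ 0)) := by
  intro R hR
  -- If one of two points at distance at most `R` lies below `p₀ + 1`, then both lie below `P`.
  set P : ℝ := momentum γ 0 + R + 1 with hP
  have hp0 := momentum_pos hγ (μ := 0) le_rfl
  obtain ⟨C₁, hC₁, hlip⟩ := h.exists_lipschitz hγ P
  set M : ℝ := P ^ 2 / 2 with hM
  have hM0 : 0 < M := by positivity
  obtain ⟨C₂, hC₂, hle⟩ := hacc M hM0
  have hmid : momentum γ 0 < momentum γ 0 + 1 := by linarith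
  set m : ℝ := Hbar (momentum γ 0 + 1)
  have hm : 0 < m := h.pos hγ hmid
  set C₃ : ℝ := (1 + 4 ^ γ / m) ^ (3 / 2 : ℝ)
  have hC₃ : 0 ≤ C₃ := by positivity
  -- Beyond `p₀ + 1` the energy is at least `m > 0`, so the velocity is Lipschitz with one constant
  -- for the whole half-line; `R^(1-β)` later converts this into a Hölder bound.
  have hfar : ∀ p q, momentum γ 0 + 1 ≤ p → momentum γ 0 + 1 ≤ q →
      |velocity γ (Hbar q) - velocity γ (Hbar p)| ≤ C₃ * |q - p| := fun p q hp hq =>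
    h.abs_velocity_sub_le hγ hC₃ hmid.le
      (fun x hx => acceleration_mul_velocity_le hγ hm (h.mono hγ hmid.le hx.le)) hp hq
  have hnear : ∀ μ ∈ Icc 0 M, ∀ ν ∈ Icc 0 M,
      |velocity γ ν - velocity γ μ| ≤ C₂ / β * |ν - μ| ^ β := by
    intro μ hμ ν hν
    have h1 := monotoneOn_sub_of_hasDerivAt_le (convex_Icc 0 M) (f := velocity γ)
      (g := fun x => C₂ / β * x ^ β) (f' := acceleration γ) (g' := fun x => C₂ * x ^ (β - 1))
      ((EffectiveHamiltonian.continuousOn_velocity hγ).mono Icc_subset_Ici_self)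
      (continuous_const.mul (Real.continuous_rpow_const hβ.le)).continuousOn
      (fun x hx => by
        rw [interior_Icc] at hx
        exact EffectiveHamiltonian.hasDerivAt_velocity hγ hx.1)
      (fun x hx => by
        rw [interior_Icc] at hx
        refine ((Real.hasDerivAt_rpow_const (Or.inl hx.1.ne')).const_mul (C₂ / β)).congr_deriv ?_
        field_simp)
      (fun x hx => by rw [interior_Icc] at hx; exact hle x hx.1 hx.2.le)
    have h2 := abs_sub_le_of_monotoneOn
      ((EffectiveHamiltonian.monotoneOn_velocity hγ).mono Icc_subset_Ici_self) h1 hμ hν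
    rw [← mul_sub, abs_mul, abs_of_nonneg (show 0 ≤ C₂ / β by positivity)] at h2
    exact h2.trans (mul_le_mul_of_nonneg_left
      (abs_rpow_sub_rpow_le hμ.1 hν.1 hβ.le hβ1) (by positivity))
  refine ⟨max (C₂ / β * C₁ ^ β) (C₃ * R ^ (1 - β)), fun p hp q hq hpq => ?_⟩
  have hp' : momentum γ 0 ≤ p := hp
  have hq' : momentum γ 0 ≤ q := hq
  have hnn : 0 ≤ |q - p| ^ β := by positivity
  by_cases hbig : momentum γ 0 + 1 ≤ p ∧ momentum γ 0 + 1 ≤ q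
  · refine le_trans ?_ (mul_le_mul_of_nonneg_right (le_max_right _ _) hnn)
    refine (hfar p q hbig.1 hbig.2).trans ?_
    rw [mul_assoc]
    refine mul_le_mul_of_nonneg_left ?_ hC₃
    calc |q - p| = |q - p| ^ (1 - β) * |q - p| ^ β := by
          rw [← Real.rpow_add_of_nonneg (abs_nonneg _) (by linarith) hβ.le]
          simp
      _ ≤ R ^ (1 - β) * |q - p| ^ β := by
          have : 0 ≤ 1 - β := by linarith
          gcongr
  · have habs := abs_le.1 hpq
    have hle2 : p ≤ P ∧ q ≤ P := by
      rw [not_and_or, not_le, not_le] at hbig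
      rcases hbig with h1 | h1 <;> constructor <;> linarith
    refine le_trans ?_ (mul_le_mul_of_nonneg_right (le_max_left _ _) hnn)
    refine (hnear _ ⟨(h.spec hγ hp).1, h.le_sq_of_le hγ hp hle2.1⟩ _
      ⟨(h.spec hγ hq).1, h.le_sq_of_le hγ hq hle2.2⟩).trans ?_
    rw [mul_assoc, ← Real.mul_rpow hC₁ (abs_nonneg _)]
    have := hlip p ⟨hp, hle2.1⟩ q ⟨hq, hle2.2⟩
    gcongr

theorem deriv_of_gt (h : IsInverseMomentum γ Hbar) (hγ : 0 < γ) (hp : momentum γ 0 < p) :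
    deriv Hbar p = velocity γ (Hbar p) := (h.hasDerivAt hγ hp).deriv

theorem hasDerivAt_of_neg (h : IsInverseMomentum γ Hbar) (hγ : 0 < γ) {v : ℝ}
    (hp : HasDerivAt Hbar v (-p)) : HasDerivAt Hbar (-v) p := by
  have h1 := HasDerivAt.comp p hp (_root_.hasDerivAt_neg p)
  have h2 : Hbar ∘ Neg.neg = Hbar := funext fun x => h.even hγ x
  rw [h2] at h1
  simpa using h1

theorem deriv_of_lt (h : IsInverseMomentum γ Hbar) (hγ : 0 < γ) (hp : p < -momentum γ 0) :
    deriv Hbar p = -velocity γ (Hbar (-p)) :=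
  (h.hasDerivAt_of_neg hγ (h.hasDerivAt hγ (by linarith))).deriv

theorem differentiableAt_of_mem (h : IsInverseMomentum γ Hbar) (hγ : 0 < γ)
    (hp : p ∈ (Icc (-momentum γ 0) (momentum γ 0))ᶜ) : DifferentiableAt ℝ Hbar p := by
  rw [mem_compl_iff, mem_Icc, not_and_or, not_le, not_le] at hp
  rcases hp with hp | hp
  · exact (h.hasDerivAt_of_neg hγ (h.hasDerivAt hγ (by linarith))).differentiableAt
  · exact (h.hasDerivAt hγ hp).differentiableAt

/-- Increment bounds for the velocity on `[p₀, ∞)` extend to the derivative of the even function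
`Hbar` outside `[-p₀, p₀]`. -/
theorem abs_deriv_sub_le (h : IsInverseMomentum γ Hbar) (hγ : 0 < γ) {β C R : ℝ} (hβ : 0 < β)
    (hC : 0 ≤ C)
    (hV : ∀ p ∈ Ici (momentum γ 0), ∀ q ∈ Ici (momentum γ 0), |q - p| ≤ R →
      |velocity γ (Hbar q) - velocity γ (Hbar p)| ≤ C * |q - p| ^ β)
    (hp : p ∈ (Icc (-momentum γ 0) (momentum γ 0))ᶜ)
    (hq : q ∈ (Icc (-momentum γ 0) (momentum γ 0))ᶜ) (hpq : |q - p| ≤ R) :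
    |deriv Hbar q - deriv Hbar p| ≤
      (2 * C + 2 * velocity γ 0 / (2 * momentum γ 0) ^ β) * |q - p| ^ β := by
  wlog hle : p ≤ q generalizing p q
  · rw [abs_sub_comm, abs_sub_comm q]
    exact this hq hp (by rwa [abs_sub_comm]) (le_of_not_ge hle)
  have hp0 := momentum_pos hγ (μ := 0) le_rfl
  have hv0 := velocity_nonneg hγ (μ := 0) le_rfl
  have hnn : 0 ≤ |q - p| ^ β := by positivity
  have hsame : C * |q - p| ^ β ≤
      (2 * C + 2 * velocity γ 0 / (2 * momentum γ 0) ^ β) * |q - p| ^ β := by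
    refine mul_le_mul_of_nonneg_right ?_ hnn
    have : 0 ≤ 2 * velocity γ 0 / (2 * momentum γ 0) ^ β := by positivity
    linarith
  rw [mem_compl_iff, mem_Icc, not_and_or, not_le, not_le] at hp hq
  rcases hp with hp | hp <;> rcases hq with hq | hq
  · rw [h.deriv_of_lt hγ hp, h.deriv_of_lt hγ hq, neg_sub_neg]
    have := hV (-q) (by rw [mem_Ici]; linarith) (-p) (by rw [mem_Ici]; linarith)
      (by rwa [neg_sub_neg])
    rw [neg_sub_neg] at this
    exact this.trans hsame
  -- Across `[-p₀, p₀]` the derivative may jump by `2 * velocity γ 0`. The two points are then at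
  -- least `2p₀` apart, so the jump is absorbed by the second term of the constant.
  · have hd : |q - p| = q - p := abs_of_nonneg (by linarith)
    rw [h.deriv_of_lt hγ hp, h.deriv_of_gt hγ hq, sub_neg_eq_add]
    have key : ∀ x, momentum γ 0 < x → x - momentum γ 0 ≤ q - p →
        |velocity γ (Hbar x)| ≤ C * |q - p| ^ β + velocity γ 0 := by
      intro x hx hxle
      have h1 := hV (momentum γ 0) (mem_Ici.2 le_rfl) x (mem_Ici.2 hx.le)
        (by rw [abs_of_nonneg (by linarith)]; linarith)
      rw [h.apply_momentum_zero hγ] at h1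
      have h2 : |x - momentum γ 0| ^ β ≤ |q - p| ^ β := by
        rw [hd, abs_of_nonneg (by linarith)]
        exact Real.rpow_le_rpow (by linarith) hxle hβ.le
      have h3 := mul_le_mul_of_nonneg_left h2 hC
      have h4 := abs_sub_abs_le_abs_sub (velocity γ (Hbar x)) (velocity γ 0)
      rw [abs_of_nonneg hv0] at h4
      linarith
    have h1 := key q hq (by linarith)
    have h2 := key (-p) (by linarith) (by linarith)
    have h3 := abs_add_le (velocity γ (Hbar q)) (velocity γ (Hbar (-p)))
    have h4 : velocity γ 0 ≤ velocity γ 0 / (2 * momentum γ 0) ^ β * |q - p| ^ β := by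
      rw [div_mul_eq_mul_div, le_div_iff₀ (by positivity)]
      refine mul_le_mul_of_nonneg_left (Real.rpow_le_rpow (by positivity) ?_ hβ.le) hv0
      rw [hd]
      linarith
    calc |velocity γ (Hbar q) + velocity γ (Hbar (-p))|
        ≤ 2 * (C * |q - p| ^ β) + 2 * velocity γ 0 := by linarith
      _ ≤ 2 * (C * |q - p| ^ β)
          + 2 * (velocity γ 0 / (2 * momentum γ 0) ^ β * |q - p| ^ β) := by linarith
      _ = _ := by ring
  · linarith
  · rw [h.deriv_of_gt hγ hp, h.deriv_of_gt hγ hq]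
    exact (hV p (mem_Ici.2 hp.le) q (mem_Ici.2 hq.le) hpq).trans hsame

end IsInverseMomentum

theorem UniformlyLocallyHolderOn.continuousOn {β : ℝ} {g : ℝ → ℝ} {S : Set ℝ} (hβ : 0 < β)
    (h : UniformlyLocallyHolderOn β g S) : ContinuousOn g S := by
  obtain ⟨C, hC⟩ := h 1 one_pos
  intro p hp
  rw [ContinuousWithinAt, tendsto_iff_dist_tendsto_zero]
  have hlim : Tendsto (fun q => C * |q - p| ^ β) (𝓝[S] p) (𝓝 0) := by
    have h1 : Continuous fun q : ℝ => C * |q - p| ^ β :=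
      continuous_const.mul ((by fun_prop : Continuous fun q : ℝ => |q - p|).rpow_const
        fun _ => Or.inr hβ.le)
    have h2 := h1.tendsto p
    rw [sub_self, abs_zero, Real.zero_rpow hβ.ne', mul_zero] at h2
    exact h2.mono_left nhdsWithin_le_nhds
  refine tendsto_of_tendsto_of_tendsto_of_le_of_le' tendsto_const_nhds hlim
    (Eventually.of_forall fun q => dist_nonneg) ?_
  filter_upwards [self_mem_nhdsWithin,
    mem_nhdsWithin_of_mem_nhds (Metric.closedBall_mem_nhds p one_pos)] with q hq hq1
  rw [Metric.mem_closedBall, Real.dist_eq] at hq1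
  exact hC p hp q hq hq1

theorem contDiffOn_one_of_deriv {f : ℝ → ℝ} {S : Set ℝ} (hS : IsOpen S)
    (hf : ∀ x ∈ S, DifferentiableAt ℝ f x) (hd : ContinuousOn (deriv f) S) : ContDiffOn ℝ 1 f S := by
  rw [show (1 : WithTop ℕ∞) = 0 + 1 from rfl, contDiffOn_succ_iff_deriv_of_isOpen hS]
  exact ⟨fun x hx => (hf x hx).differentiableWithinAt, by simp, contDiffOn_zero.2 hd⟩

namespace IsInverseMomentum

theorem isC1HolderOn_compl (h : IsInverseMomentum γ Hbar) (hγ : 0 < γ) {β : ℝ} (hβ : 0 < β)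
    (hV : UniformlyLocallyHolderOn β (fun p => velocity γ (Hbar p)) (Ici (momentum γ 0))) :
    IsC1HolderOn β Hbar (Icc (-momentum γ 0) (momentum γ 0))ᶜ := by
  have hd : UniformlyLocallyHolderOn β (deriv Hbar) (Icc (-momentum γ 0) (momentum γ 0))ᶜ := by
    intro R hR
    obtain ⟨C, hC⟩ := hV R hR
    refine ⟨_, fun p hp q hq hpq => h.abs_deriv_sub_le hγ hβ (le_max_right C 0)
      (fun x hx y hy hxy => (hC x hx y hy hxy).trans ?_) hp hq hpq⟩
    exact mul_le_mul_of_nonneg_right (le_max_left C 0) (by positivity)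
  exact ⟨contDiffOn_one_of_deriv isClosed_Icc.isOpen_compl
    (fun x hx => h.differentiableAt_of_mem hγ hx)
    (UniformlyLocallyHolderOn.continuousOn hβ hd), hd⟩

/-- At most one of the two terms is nonzero, since the velocity vanishes at `p₀`. In this form
Hölder continuity on the whole line follows because `p ↦ max p p₀` is 1-Lipschitz. -/
theorem hasDerivAt_of_velocity_zero (h : IsInverseMomentum γ Hbar) (hγ : 0 < γ)
    (hv : velocity γ 0 = 0) (p : ℝ) :
    HasDerivAt Hbar (velocity γ (Hbar (max p (momentum γ 0)))
      - velocity γ (Hbar (max (-p) (momentum γ 0)))) p := by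
  have hp0 := momentum_pos hγ (μ := 0) le_rfl
  have hz := h.apply_momentum_zero hγ
  have key : ∀ p, 0 ≤ p → HasDerivAt Hbar (velocity γ (Hbar (max p (momentum γ 0)))
      - velocity γ (Hbar (max (-p) (momentum γ 0)))) p := by
    intro p hp
    rw [max_eq_right (show -p ≤ momentum γ 0 by linarith), hz, hv, sub_zero]
    have hzero : ∀ {q}, -momentum γ 0 < q → q ≤ momentum γ 0 → Hbar q = 0 := fun h1 h2 =>
      h.eq_zero _ (abs_le.2 ⟨h1.le, h2⟩)
    rcases lt_trichotomy p (momentum γ 0) with h1 | h1 | h1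
    · rw [max_eq_right h1.le, hz, hv]
      refine (hasDerivAt_const p (0 : ℝ)).congr_of_eventuallyEq ?_
      filter_upwards [Ioo_mem_nhds (show -momentum γ 0 < p by linarith) h1] with q hq
      exact hzero hq.1 hq.2.le
    · subst h1
      rw [max_self]
      have hr := h.hasDerivWithinAt hγ le_rfl
      have hl : HasDerivWithinAt Hbar (velocity γ (Hbar (momentum γ 0))) (Iic (momentum γ 0))
          (momentum γ 0) := by
        rw [hz, hv]
        refine (hasDerivWithinAt_const _ _ (0 : ℝ)).congr_of_eventuallyEq ?_ hz
        filter_upwards [self_mem_nhdsWithin, mem_nhdsWithin_of_mem_nhds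
          (Ioi_mem_nhds (show -momentum γ 0 < momentum γ 0 by linarith))] with q hq hq'
        exact hzero hq' hq
      have hu := hl.union hr
      rwa [Iic_union_Ici, hasDerivWithinAt_univ] at hu
    · rw [max_eq_left h1.le]
      exact h.hasDerivAt hγ h1
  rcases le_total 0 p with hp | hp
  · exact key p hp
  · have h1 := h.hasDerivAt_of_neg hγ (key (-p) (by linarith))
    rwa [neg_neg, neg_sub] at h1

theorem isC1HolderOn_univ (h : IsInverseMomentum γ Hbar) (hγ : 0 < γ) (hv : velocity γ 0 = 0)
    {β : ℝ} (hβ : 0 < β)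
    (hV : UniformlyLocallyHolderOn β (fun p => velocity γ (Hbar p)) (Ici (momentum γ 0))) :
    IsC1HolderOn β Hbar univ := by
  have hderiv := h.hasDerivAt_of_velocity_zero hγ hv
  have hd : UniformlyLocallyHolderOn β (deriv Hbar) univ := by
    intro R hR
    obtain ⟨C, hC⟩ := hV R hR
    refine ⟨2 * max C 0, fun p _ q _ hpq => ?_⟩
    rw [(hderiv p).deriv, (hderiv q).deriv]
    have key : ∀ x y, |y - x| = |q - p| →
        |velocity γ (Hbar (max y (momentum γ 0))) - velocity γ (Hbar (max x (momentum γ 0)))|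
          ≤ max C 0 * |q - p| ^ β := by
      intro x y hxy
      have h1 := abs_max_sub_max_le_abs y x (momentum γ 0)
      rw [hxy] at h1
      refine (hC _ (mem_Ici.2 (le_max_right _ _)) _ (mem_Ici.2 (le_max_right _ _))
        (h1.trans hpq)).trans ?_
      exact mul_le_mul (le_max_left _ _) (Real.rpow_le_rpow (abs_nonneg _) h1 hβ.le)
        (by positivity) (le_max_right _ _)
    have h1 := abs_le.1 (key p q rfl)
    have h2 := abs_le.1 (key (-p) (-q) (by rw [neg_sub_neg, abs_sub_comm]))
    rw [abs_le]
    constructor <;> linarith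
  exact ⟨contDiffOn_one_of_deriv isOpen_univ (fun x _ => (hderiv x).differentiableAt)
    (UniformlyLocallyHolderOn.continuousOn hβ hd), hd⟩

end IsInverseMomentum

end

/-! ### Reduction to a translate of `cosSum`, and logarithmic estimates. -/

section

theorem integral_unit_square_eq {f : ℝ × ℝ → ℝ} (hf : Continuous f)
    (h1 : ∀ x y, f (x + 1, y) = f (x, y)) (h2 : ∀ x y, f (x, y + 1) = f (x, y)) (θ : ℝ) :
    ∫ x in (0 : ℝ)..1, ∫ y in (0 : ℝ)..1, f (x - θ, y - θ) = ∫ x in cell, f x := by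
  have key : ∀ g : ℝ → ℝ, (∀ x, g (x + 1) = g x) →
      ∫ x in (0 : ℝ)..1, g (x - θ) = ∫ x in (-(1 / 2) : ℝ)..(1 / 2), g x := by
    intro g hg
    have := Function.Periodic.intervalIntegral_add_eq (f := g) (T := 1) hg (0 - θ) (-(1 / 2))
    rw [intervalIntegral.integral_comp_sub_right]
    convert this using 2 <;> ring
  rw [integral_cell_eq hf, ← key (fun x => ∫ y in (-(1 / 2) : ℝ)..(1 / 2), f (x, y))
    (fun x => by simp_rw [h1])]
  refine intervalIntegral.integral_congr fun x _ => ?_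
  exact key (fun y => f (x - θ, y)) fun y => h2 _ _

theorem cosSum_add_one_fst (x y : ℝ) : cosSum (x + 1, y) = cosSum (x, y) := by
  simp only [cosSum, mul_add, mul_one, Real.cos_add_two_pi]

theorem cosSum_add_one_snd (x y : ℝ) : cosSum (x, y + 1) = cosSum (x, y) := by
  simp only [cosSum, mul_add, mul_one, Real.cos_add_two_pi]

theorem criticalMomentum_eq {γ : ℝ} (hγ : 0 < γ) {U : ℝ × ℝ → ℝ} {θ : ℝ}
    (hU : ∀ x y, U (x, y) = cosSum (x - θ, y - θ) ^ γ) :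
    criticalMomentum U = momentum γ 0 := by
  have h := integral_unit_square_eq (f := fun x => speed γ 0 (cosSum x))
    ((continuous_speed hγ).comp continuous_cosSum) (fun x y => by rw [cosSum_add_one_fst])
    (fun x y => by rw [cosSum_add_one_snd]) θ
  rw [momentum, cosMean, ← h, criticalMomentum]
  simp_rw [hU, speed, zero_add]

theorem mechanicalHamiltonian_eq {γ : ℝ} {U : ℝ × ℝ → ℝ} {θ : ℝ} (ξ : ℝ × ℝ)
    (hU : ∀ x y, U (x, y) = cosSum (x - θ, y - θ) ^ γ) :
    mechanicalHamiltonian (quasiPeriodicPotential U ξ) = lineHamiltonian γ ξ θ := by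
  unfold lineHamiltonian
  congr 1
  funext x
  rw [quasiPeriodicPotential, hU, cosLine]

/-- A sine is a cosine delayed by a quarter period, in both variables alike. -/
theorem exists_shift {γ : ℝ} {U : ℝ × ℝ → ℝ} (hU : U = sinSuspension γ ∨ U = cosSuspension γ) :
    ∃ θ : ℝ, ∀ x y, U (x, y) = cosSum (x - θ, y - θ) ^ γ := by
  rcases hU with rfl | rfl
  · refine ⟨1 / 4, fun x y => ?_⟩
    have h : ∀ t : ℝ, Real.cos (2 * Real.pi * (t - 1 / 4)) = Real.sin (2 * Real.pi * t) := by
      intro t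
      rw [← Real.cos_sub_pi_div_two]
      ring_nf
    simp only [sinSuspension, cosSum, h]
  · exact ⟨0, fun x y => by simp only [cosSuspension, cosSum, sub_zero]⟩

variable {γ : ℝ}

/-- Comparison of the increments of the velocity with those of `f`, on a convex set of energies. -/
theorem abs_velocity_sub_le (hγ : 0 < γ) {D : Set ℝ} (hD : Convex ℝ D) (hD0 : D ⊆ Ici 0)
    {f f' : ℝ → ℝ} {C : ℝ} (hC : 0 ≤ C) (hf : ContinuousOn f D)
    (hf' : ∀ x ∈ interior D, HasDerivAt f (f' x) x)
    (hle : ∀ x ∈ interior D, acceleration γ x ≤ C * f' x) {μ ν : ℝ} (hμ : μ ∈ D) (hν : ν ∈ D) :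
    |velocity γ ν - velocity γ μ| ≤ C * |f ν - f μ| := by
  have hint : interior D ⊆ Ioi 0 := by
    rw [← interior_Ici]; exact interior_mono hD0
  have h1 := monotoneOn_sub_of_hasDerivAt_le hD (g := fun x => C * f x) ((continuousOn_velocity hγ).mono hD0)
    (continuousOn_const.mul hf) (fun x hx => hasDerivAt_velocity hγ (hint hx))
    (fun x hx => (hf' x hx).const_mul C) hle
  have h2 := abs_sub_le_of_monotoneOn ((monotoneOn_velocity hγ).mono hD0) h1 hμ hν
  rwa [← mul_sub, abs_mul, abs_of_nonneg hC] at h2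

theorem hasDerivAt_mul_sub_log (a : ℝ) {x : ℝ} (hx : 0 < x) :
    HasDerivAt (fun x => a * x - x * Real.log x) (a - 1 - Real.log x) x := by
  refine (((hasDerivAt_id x).const_mul a).fun_sub (Real.hasDerivAt_mul_log hx.ne')).congr_deriv ?_
  ring

theorem continuous_mul_sub_log (a : ℝ) : Continuous fun x => a * x - x * Real.log x :=
  (continuous_const.mul continuous_id).sub Real.continuous_mul_log

theorem abs_velocity_sub_le_log_two (hγ : γ = 2 / 3) :
    ∃ C, ∀ μ, 0 ≤ μ → ∀ ν, 0 ≤ ν → |velocity γ ν - velocity γ μ| ≤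
      C * |ν * (2 + |Real.log ν|) - μ * (2 + |Real.log μ|)| := by
  have hγ0 : 0 < γ := by rw [hγ]; norm_num
  obtain ⟨C, hC, h1, h2⟩ := acceleration_le_of_eq hγ
  refine ⟨C, fun μ hμ ν hν => ?_⟩
  -- Up to the factor `C`, the derivative is `1 - log x` below `1`, exactly the available bound, and
  -- `3 + log x ≥ 1` above. The kink at `1` is handled by gluing two monotone pieces.
  set Φ : ℝ → ℝ := fun x => C * (x * (2 + |Real.log x|)) with hΦ
  have hlow : MonotoneOn (fun x => Φ x - velocity γ x) (Icc 0 1) := by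
    have := monotoneOn_sub_of_hasDerivAt_le (convex_Icc 0 1)
      (g := fun x => C * (2 * x - x * Real.log x))
      ((continuousOn_velocity hγ0).mono Icc_subset_Ici_self)
      (continuous_const.mul (continuous_mul_sub_log 2)).continuousOn
      (fun x hx => by rw [interior_Icc] at hx; exact hasDerivAt_velocity hγ0 hx.1)
      (fun x hx => by
        rw [interior_Icc] at hx; exact (hasDerivAt_mul_sub_log 2 hx.1).const_mul C)
      (fun x hx => by
        rw [interior_Icc] at hx
        refine (h1 x hx.1 hx.2.le).trans (le_of_eq ?_)
        ring)
    refine this.congr fun x hx => ?_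
    simp only [hΦ]
    rw [abs_of_nonpos (Real.log_nonpos hx.1 hx.2)]
    ring
  have hhigh : MonotoneOn (fun x => Φ x - velocity γ x) (Ici 1) := by
    have hd : ∀ x : ℝ, 0 < x →
        HasDerivAt (fun x => C * (2 * x + x * Real.log x)) (C * (3 + Real.log x)) x := by
      intro x hx
      refine ((((hasDerivAt_id x).const_mul 2).fun_add
        (Real.hasDerivAt_mul_log hx.ne')).const_mul C).congr_deriv ?_
      ring
    have := monotoneOn_sub_of_hasDerivAt_le (convex_Ici 1)
      ((continuousOn_velocity hγ0).mono (Ici_subset_Ici.2 zero_le_one))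
      (fun x (hx : 1 ≤ x) => (hd x (by linarith)).continuousAt.continuousWithinAt)
      (fun x hx => by
        rw [interior_Ici] at hx; exact hasDerivAt_velocity hγ0 (one_pos.trans hx))
      (fun x hx => by
        rw [interior_Ici] at hx; exact hd x (one_pos.trans hx))
      (fun x hx => by
        rw [interior_Ici] at hx
        have hx1 : 1 ≤ x := le_of_lt hx
        refine (h2 x hx1).trans (le_mul_of_one_le_right hC ?_)
        linarith [Real.log_nonneg hx1])
    refine this.congr fun x hx => ?_
    simp only [hΦ]
    rw [abs_of_nonneg (Real.log_nonneg hx)]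
    ring
  have hall : MonotoneOn (fun x => Φ x - velocity γ x) (Ici 0) := by
    rw [← Icc_union_Ici_eq_Ici (zero_le_one (α := ℝ))]
    exact hlow.union_right hhigh (isGreatest_Icc zero_le_one) isLeast_Ici
  have h3 := abs_sub_le_of_monotoneOn (monotoneOn_velocity hγ0) hall hμ hν
  rwa [← mul_sub, abs_mul, abs_of_nonneg hC] at h3

theorem abs_velocity_sub_le_log_one (hγ : γ = 2 / 3) {m : ℝ} (hm : m < 1) :
    ∃ C, ∀ μ, 0 ≤ μ → μ ≤ m → ∀ ν, 0 ≤ ν → ν ≤ m → |velocity γ ν - velocity γ μ| ≤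
      C * |ν * (1 + |Real.log ν|) - μ * (1 + |Real.log μ|)| := by
  have hγ0 : 0 < γ := by rw [hγ]; norm_num
  obtain ⟨C, hC, h1, -⟩ := acceleration_le_of_eq hγ
  -- The derivative of `x(1 - log x)` is `-log x`, which degenerates at `1`. On `(0, n)` with `n <
  -- 1` it is at least `k > 0`, so `1 - log x ≤ (k⁻¹ + 1)(-log x)`; the value `1/2` only keeps `n`
  -- positive.
  set n : ℝ := max m (1 / 2) with hn
  have hn0 : 0 < n := lt_max_of_lt_right (by norm_num)
  have hn1 : n < 1 := max_lt hm (by norm_num)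
  set k : ℝ := -Real.log n with hk
  have hk0 : 0 < k := neg_pos.2 (Real.log_neg hn0 hn1)
  have key : ∀ x, 0 ≤ x → x ≤ m → 1 * x - x * Real.log x = x * (1 + |Real.log x|) := by
    intro x hx hxm
    rw [abs_of_nonpos (Real.log_nonpos hx (by linarith))]
    ring
  refine ⟨C * (k⁻¹ + 1), fun μ hμ hμm ν hν hνm => ?_⟩
  rw [← key μ hμ hμm, ← key ν hν hνm]
  refine abs_velocity_sub_le hγ0 (convex_Icc 0 n) Icc_subset_Ici_self
    (f := fun x => 1 * x - x * Real.log x) (f' := fun x => 1 - 1 - Real.log x) (by positivity)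
    (continuous_mul_sub_log 1).continuousOn
    (fun x hx => by rw [interior_Icc] at hx; exact hasDerivAt_mul_sub_log 1 hx.1) (fun x hx => ?_)
    ⟨hμ, hμm.trans (le_max_left _ _)⟩ ⟨hν, hνm.trans (le_max_left _ _)⟩
  rw [interior_Icc] at hx
  refine (h1 x hx.1 (hx.2.le.trans hn1.le)).trans ?_
  rw [mul_assoc]
  refine mul_le_mul_of_nonneg_left ?_ hC
  have h2 : k ≤ -Real.log x := neg_le_neg (Real.log_le_log hx.1 hx.2.le)
  have h3 : 1 ≤ k⁻¹ * -Real.log x := by rw [le_inv_mul_iff₀ hk0]; linarith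
  linarith

theorem abs_velocity_sub_le_log (hγ : γ = 2) (M : ℝ) (hM : 0 < M) :
    ∃ C, ∀ μ, 0 < μ → μ ≤ M → ∀ ν, 0 < ν → ν ≤ M →
      |velocity γ ν - velocity γ μ| ≤ C * |Real.log ν - Real.log μ| := by
  have hγ0 : 0 < γ := by rw [hγ]; norm_num
  obtain ⟨C, hC, h⟩ := acceleration_le_of_two_thirds_lt (γ := γ) (by rw [hγ]; norm_num) M hM
  refine ⟨C, fun μ hμ hμM ν hν hνM => ?_⟩
  refine abs_velocity_sub_le hγ0 (convex_Ioc 0 M) (fun x hx => hx.1.le) (f := Real.log)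
    (f' := fun x => x⁻¹) hC (fun x hx => (Real.continuousAt_log hx.1.ne').continuousWithinAt)
    (fun x hx => Real.hasDerivAt_log (interior_subset hx).1.ne') (fun x hx => ?_)
    ⟨hμ, hμM⟩ ⟨hν, hνM⟩
  have hx' := interior_subset hx
  have h1 := h x hx'.1 hx'.2
  rw [hγ, show (1 / 2 - 1 / 2 - 1 : ℝ) = -1 by norm_num, Real.rpow_neg_one] at h1
  rwa [hγ]

end

end EffectiveHamiltonian

open EffectiveHamiltonian

theorem mainTheorem8 (γ : ℝ) (hγ : 0 < γ) (ξ : ℝ × ℝ) (hξ : NonResonant ξ)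
    (U : ℝ × ℝ → ℝ) (hU : U = sinSuspension γ ∨ U = cosSuspension γ) 
    (Hbar : ℝ → ℝ)
    (hHbar : Hbar =
      effectiveHamiltonian (mechanicalHamiltonian (quasiPeriodicPotential U ξ)))
    (p₀ : ℝ) (hp₀ : p₀ = criticalMomentum U)
    -- the derivative of `Hbar` on `[p₀, ∞)`, one-sided at `p₀`
    (dHbar : ℝ → ℝ) (hdHbar : dHbar = derivWithin Hbar (Set.Ici p₀)) :
    DifferentiableOn ℝ Hbar (Set.Ici p₀) ∧
    (2 < γ →
      UniformlyLocallyHolderOn (1 / 2 - 1 / γ) dHbar (Set.Ici p₀) ∧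
      IsC1HolderOn (1 / 2 - 1 / γ) Hbar Set.univ) ∧
    (γ = 2 → ∀ M : ℝ, ∃ C : ℝ, ∀ p ∈ Set.Ioc p₀ M, ∀ q ∈ Set.Ioc p₀ M,
      |dHbar q - dHbar p| ≤ C * |Real.log (Hbar q) - Real.log (Hbar p)|) ∧
    (2 / 3 < γ → γ < 2 →
      UniformlyLocallyHolderOn (1 / γ - 1 / 2) dHbar (Set.Ici p₀) ∧
      IsC1HolderOn (1 / γ - 1 / 2) Hbar (Set.Icc (-p₀) p₀)ᶜ) ∧
    (γ = 2 / 3 →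
      (∃ C : ℝ, ∀ p ∈ Set.Ici p₀, ∀ q ∈ Set.Ici p₀,
        |dHbar q - dHbar p| ≤
          C * |Hbar q * (2 + |Real.log (Hbar q)|) - Hbar p * (2 + |Real.log (Hbar p)|)|) ∧
      (∀ m : ℝ, m < 1 → ∃ C : ℝ, ∀ p ∈ Set.Ici p₀, ∀ q ∈ Set.Ici p₀,
        Hbar p ≤ m → Hbar q ≤ m →
        |dHbar q - dHbar p| ≤
          C * |Hbar q * (1 + |Real.log (Hbar q)|) - Hbar p * (1 + |Real.log (Hbar p)|)|)) ∧
    (γ < 2 / 3 →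
      (∃ C : ℝ, ∀ p ∈ Set.Ici p₀, ∀ q ∈ Set.Ici p₀,
        |dHbar q - dHbar p| ≤ C * |q - p|) ∧
      ContDiffOn ℝ 1 Hbar (Set.Icc (-p₀) p₀)ᶜ ∧
      ∃ K, LipschitzOnWith K (deriv Hbar) (Set.Icc (-p₀) p₀)ᶜ) := by

  obtain ⟨θ, hθ⟩ := exists_shift hU
  have hinv : IsInverseMomentum γ Hbar := by
    rw [hHbar, mechanicalHamiltonian_eq ξ hθ]
    exact isInverseMomentum_effectiveHamiltonian hγ hξ θ
  have hp : p₀ = momentum γ 0 := hp₀.trans (criticalMomentum_eq hγ hθ)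
  subst hp
  have hd : ∀ p ∈ Set.Ici (momentum γ 0), dHbar p = velocity γ (Hbar p) := fun p hp => by
    rw [hdHbar]; exact hinv.derivWithin_eq hγ hp
  have hcongr : ∀ {β}, UniformlyLocallyHolderOn β (fun p => velocity γ (Hbar p))
      (Set.Ici (momentum γ 0)) → UniformlyLocallyHolderOn β dHbar (Set.Ici (momentum γ 0)) := by
    intro β h R hR
    obtain ⟨C, hC⟩ := h R hR
    refine ⟨C, fun p hp q hq hpq => ?_⟩
    rw [hd p hp, hd q hq]
    exact hC p hp q hq hpq
  refine ⟨fun p hp => (hinv.hasDerivWithinAt hγ hp).differentiableWithinAt, fun hγ2 => ?_,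
    fun hγ2 M => ?_, fun hγ1 hγ2 => ?_, fun hγ2 => ⟨?_, fun m hm => ?_⟩, fun hγ2 => ?_⟩
  · have hβ : 0 < 1 / 2 - 1 / γ := by
      have : 1 / γ < 1 / 2 := one_div_lt_one_div_of_lt (by norm_num) hγ2
      linarith
    have hβ1 : 1 / 2 - 1 / γ ≤ 1 := by
      have : 0 < 1 / γ := by positivity
      linarith
    have h := hinv.uniformlyLocallyHolderOn_velocity hγ hβ hβ1
      (acceleration_le_of_two_lt hγ2)
    exact ⟨hcongr h, hinv.isC1HolderOn_univ hγ (velocity_zero_of_two_lt hγ2) hβ h⟩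
  · by_cases hM : momentum γ 0 < M
    · have hM0 : 0 < M := (momentum_pos hγ le_rfl).trans hM
      obtain ⟨C, hC⟩ := abs_velocity_sub_le_log hγ2 (M ^ 2 / 2) (by positivity)
      refine ⟨C, fun p hp q hq => ?_⟩
      rw [hd p hp.1.le, hd q hq.1.le]
      exact hC _ (hinv.pos hγ hp.1) (hinv.le_sq_of_le hγ hp.1.le hp.2) _ (hinv.pos hγ hq.1)
        (hinv.le_sq_of_le hγ hq.1.le hq.2)
    · exact ⟨0, fun p hp => absurd (hp.1.trans_le hp.2) hM⟩
  · have hβ : 0 < 1 / γ - 1 / 2 := by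
      have : 1 / 2 < 1 / γ := one_div_lt_one_div_of_lt hγ hγ2
      linarith
    have hβ1 : 1 / γ - 1 / 2 ≤ 1 := by
      have : 1 / γ < 1 / (2 / 3) := one_div_lt_one_div_of_lt (by norm_num) hγ1
      norm_num at this ⊢
      linarith
    have h := hinv.uniformlyLocallyHolderOn_velocity hγ hβ hβ1
      (acceleration_le_of_two_thirds_lt hγ1)
    exact ⟨hcongr h, hinv.isC1HolderOn_compl hγ hβ h⟩
  · obtain ⟨C, hC⟩ := abs_velocity_sub_le_log_two hγ2
    refine ⟨C, fun p hp q hq => ?_⟩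
    rw [hd p hp, hd q hq]
    exact hC _ (hinv.spec hγ hp).1 _ (hinv.spec hγ hq).1
  · obtain ⟨C, hC⟩ := abs_velocity_sub_le_log_one hγ2 hm
    refine ⟨C, fun p hp q hq hpm hqm => ?_⟩
    rw [hd p hp, hd q hq]
    exact hC _ (hinv.spec hγ hp).1 hpm _ (hinv.spec hγ hq).1 hqm
  · obtain ⟨C, hC0, hC⟩ := acceleration_mul_velocity_le_of_lt hγ hγ2
    have hV : ∀ p ∈ Set.Ici (momentum γ 0), ∀ q ∈ Set.Ici (momentum γ 0),
        |velocity γ (Hbar q) - velocity γ (Hbar p)| ≤ C * |q - p| := fun p hp q hq =>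
      hinv.abs_velocity_sub_le hγ hC0 le_rfl (fun x hx => hC _ (hinv.pos hγ hx)) hp hq
    refine ⟨⟨C, fun p hp q hq => ?_⟩, ?_, ?_⟩
    · rw [hd p hp, hd q hq]
      exact hV p hp q hq
    · refine (hinv.isC1HolderOn_compl hγ one_pos fun R _ => ⟨C, fun p hp q hq _ => ?_⟩).1
      rw [Real.rpow_one]
      exact hV p hp q hq
    · set K : ℝ := 2 * C + 2 * velocity γ 0 / (2 * momentum γ 0) ^ (1 : ℝ) with hK
      have hK0 : 0 ≤ K := by
        have h1 := momentum_pos hγ (μ := 0) le_rfl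
        have h2 := velocity_nonneg hγ (μ := 0) le_rfl
        positivity
      refine ⟨K.toNNReal, LipschitzOnWith.of_dist_le_mul fun p hp q hq => ?_⟩
      rw [Real.dist_eq, Real.dist_eq, Real.coe_toNNReal _ hK0]
      -- The Lipschitz bound `hV` is global, so `R` can be the distance itself and `K` does not
      -- depend on it.
      have := hinv.abs_deriv_sub_le hγ (R := |p - q|) one_pos hC0
        (fun x hx y hy _ => by rw [Real.rpow_one]; exact hV x hx y hy) hq hp le_rfl
      rwa [Real.rpow_one (|p - q|)] at this
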